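/- Let $\mathbb F$ be a field of characteristic zero and let $m\ge n\ge 0$ be integers with $m+n\ge 1$. Let $\mathfrak g$ be the split simple Lie superalgebra of type $A(m,n)$ over $\mathbb F$: if $m\neq n$, $\mathfrak g=\mathfrak{sl}_{m+1,n+1}(\mathbb F)$, the Lie superalgebra (under the supercommutator) of $((m+1)+(n+1))\times((m+1)+(n+1))$ block matrices of supertrace zero; if $m=n$, $\mathfrak g=\mathfrak{psl}_{n+1,n+1}(\mathbb F)=\mathfrak{sl}_{n+1,n+1}(\mathbb F)/\mathbb F I$. Let $\mathfrak h\subset\mathfrak g$ be the Cartan subalgebra of diagonal matrices (modulo $\mathbb F I$ if $m=n$), for $\mu\in\mathfrak h^*$ and a $\mathfrak g$-module $V$ let $V_\mu=\{v\in V\mid h.v=\mu(h)v \text{ for all } h\in\mathfrak h\}$, and let $\Delta=\{\mu\in\mathfrak h^*\mid \mu\ne0,\ \mathfrak g_\mu\neq0\}$ be the set of roots, where $\mathfrak g_\mu$ refers to the adjoint module. Modules are $\mathbb Z/2$-graded, a module is irreducible if it is nonzero and has no graded submodules other than $0$ and itself, and isomorphisms are even. Then a $\mathfrak g$-module $V$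 is finite-dimensional and irreducible, is the sum of its weight spaces $V_\mu$ ($\mu\in\mathfrak h^*$), and has all its weights (the $\mu$ with $V_\mu\ne0$) in $\Delta\cup\{0\}$ if and only if $V$ is isomorphic to the adjoint module $\mathfrak g$, to the one-dimensional trivial module $\mathbb F$, or to one of these two with the parity changed. -/

import Mathlib

/-! Superspaces, Lie superalgebras and their modules, and the Lie superalgebras of type `A(m,n)`. -/

/-- A `ℤ/2`-grading `V = V₀ ⊕ V₁` of a vector space. -/
structure SuperGrading (F V : Type*) [Field F] [AddCommGroup V] [Module F V] where
  part : ZMod 2 → Submodule F V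
  isCompl : IsCompl (part 0) (part 1)

namespace SuperGrading

variable {F V : Type*} [Field F] [AddCommGroup V] [Module F V]

/-- `W = (W ∩ V₀) + (W ∩ V₁)`: the subspace `W` is a graded subspace of `V`. -/
def IsGraded (G : SuperGrading F V) (W : Submodule F V) : Prop :=
  W ≤ (W ⊓ G.part 0) ⊔ (W ⊓ G.part 1)

/-- The grading of a graded subspace: `W i = W ∩ V i`. -/
def restrict (G : SuperGrading F V) (W : Submodule F V) (hW : G.IsGraded W) :
    SuperGrading F W where
  part i := (G.part i).comap W.subtype
  isCompl := by
    constructor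
    · rw [Submodule.disjoint_def]
      intro x h0 h1
      exact Subtype.ext (Submodule.disjoint_def.1 G.isCompl.disjoint x.1 h0 h1)
    · rw [codisjoint_iff, eq_top_iff]
      rintro ⟨x, hx⟩ -
      obtain ⟨a, ha, b, hb, hab⟩ := Submodule.mem_sup.1 (hW hx)
      exact Submodule.mem_sup.2 ⟨⟨a, ha.1⟩, ha.2, ⟨b, hb.1⟩, hb.2, Subtype.ext hab⟩

/-- The grading of the quotient by a graded subspace: `(V/W) i` is the image of `V i`. -/
def quotient (G : SuperGrading F V) (W : Submodule F V) (hW : G.IsGraded W) :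
    SuperGrading F (V ⧸ W) where
  part i := (G.part i).map W.mkQ
  isCompl := by
    constructor
    · rw [Submodule.disjoint_def]
      rintro x ⟨a, ha, rfl⟩ ⟨b, hb, hab⟩
      have h : a - b ∈ W := by
        rw [← W.ker_mkQ, LinearMap.mem_ker, map_sub, hab, sub_self]
      obtain ⟨c, hc, d, hd, hcd⟩ := Submodule.mem_sup.1 (hW h)
      have h0 : a - c = 0 := by
        refine Submodule.disjoint_def.1 G.isCompl.disjoint _ (sub_mem ha hc.2) ?_
        have : a - c = b + d := by
          rw [sub_eq_iff_eq_add, add_assoc, add_comm d c, hcd, add_sub_cancel]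
        rw [this]
        exact add_mem hb hd.2
      rw [sub_eq_zero.1 h0, ← LinearMap.mem_ker, W.ker_mkQ]
      exact hc.1
    · rw [codisjoint_iff, ← Submodule.map_sup, codisjoint_iff.1 G.isCompl.codisjoint,
        Submodule.map_top, Submodule.range_mkQ]

/-- The grading with the two parities exchanged. -/
def parityChange (G : SuperGrading F V) : SuperGrading F V where
  part i := G.part (i + 1)
  isCompl := by
    have h : (1 + 1 : ZMod 2) = 0 := by decide
    rw [zero_add, h]
    exact G.isCompl.symm

end SuperGrading

/-- The sign `(-1)^{ij}`. -/
def koszulSign (F : Type*) [Field F] (i j : ZMod 2) : F :=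
  if i = 1 ∧ j = 1 then -1 else 1

/-- A Lie superalgebra (in characteristic `0`) with underlying vector space `L`: a graded bilinear
bracket that is super skew-symmetric and satisfies the super Jacobi identity. -/
structure LieSuperalgebra (F L : Type*) [Field F] [AddCommGroup L] [Module F L] where
  grading : SuperGrading F L
  bracket : L →ₗ[F] L →ₗ[F] L
  bracket_mem : ∀ {i j : ZMod 2} {x y : L}, x ∈ grading.part i → y ∈ grading.part j →
    bracket x y ∈ grading.part (i + j)
  skew : ∀ {i j : ZMod 2} {x y : L}, x ∈ grading.part i → y ∈ grading.part j →
    bracket x y = -(koszulSign F i j • bracket y x)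
  jacobi : ∀ {i j : ZMod 2} {x y : L}, x ∈ grading.part i → y ∈ grading.part j → ∀ z : L,
    bracket x (bracket y z) =
      bracket (bracket x y) z + koszulSign F i j • bracket y (bracket x z)

namespace LieSuperalgebra

variable {F L : Type*} [Field F] [AddCommGroup L] [Module F L]

/-- A graded subspace closed under the bracket, as a Lie superalgebra. -/
def subalgebra (𝔤 : LieSuperalgebra F L) (S : Submodule F L) (hS : 𝔤.grading.IsGraded S)
    (hb : ∀ x ∈ S, ∀ y ∈ S, 𝔤.bracket x y ∈ S) : LieSuperalgebra F S where
  grading := 𝔤.grading.restrict S hS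
  bracket := LinearMap.mk₂ F (fun x y => ⟨𝔤.bracket x.1 y.1, hb _ x.2 _ y.2⟩)
    (fun _ _ _ => Subtype.ext (by simp)) (fun _ _ _ => Subtype.ext (by simp))
    (fun _ _ _ => Subtype.ext (by simp)) (fun _ _ _ => Subtype.ext (by simp))
  bracket_mem hx hy := 𝔤.bracket_mem hx hy
  skew hx hy := Subtype.ext (𝔤.skew hx hy)
  jacobi hx hy z := Subtype.ext (𝔤.jacobi hx hy z.1)

/-- The bilinear map induced on `L/I`, with `(x + I, y + I) ↦ [x, y] + I`. -/
def quotientBracket (b : L →ₗ[F] L →ₗ[F] L) (I : Submodule F L)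
    (hl : ∀ x ∈ I, ∀ y, b x y ∈ I) (hr : ∀ x, ∀ y ∈ I, b x y ∈ I) :
    (L ⧸ I) →ₗ[F] (L ⧸ I) →ₗ[F] (L ⧸ I) :=
  I.liftQ
    { toFun := fun x => I.mapQ I (b x) (fun y hy => hr x y hy)
      map_add' := fun x x' => Submodule.linearMap_qext _ (LinearMap.ext fun y => by simp)
      map_smul' := fun c x => Submodule.linearMap_qext _ (LinearMap.ext fun y => by simp) }
    (fun x hx => by
      refine LinearMap.mem_ker.2 (Submodule.linearMap_qext _ (LinearMap.ext fun y => ?_))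
      exact (Submodule.Quotient.mk_eq_zero I).2 (hl x hx y))

theorem quotientBracket_mkQ (b : L →ₗ[F] L →ₗ[F] L) (I : Submodule F L)
    (hl : ∀ x ∈ I, ∀ y, b x y ∈ I) (hr : ∀ x, ∀ y ∈ I, b x y ∈ I) (x y : L) :
    quotientBracket b I hl hr (I.mkQ x) (I.mkQ y) = I.mkQ (b x y) := rfl

/-- The quotient of a Lie superalgebra by a graded (two-sided) ideal. -/
def quotient (𝔤 : LieSuperalgebra F L) (I : Submodule F L) (hI : 𝔤.grading.IsGraded I)
    (hl : ∀ x ∈ I, ∀ y, 𝔤.bracket x y ∈ I) (hr : ∀ x, ∀ y ∈ I, 𝔤.bracket x y ∈ I) :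
    LieSuperalgebra F (L ⧸ I) where
  grading := 𝔤.grading.quotient I hI
  bracket := quotientBracket 𝔤.bracket I hl hr
  bracket_mem := by
    rintro i j _ _ ⟨x, hx, rfl⟩ ⟨y, hy, rfl⟩
    exact ⟨_, 𝔤.bracket_mem hx hy, rfl⟩
  skew := by
    rintro i j _ _ ⟨x, hx, rfl⟩ ⟨y, hy, rfl⟩
    simp only [quotientBracket_mkQ]
    rw [𝔤.skew hx hy, map_neg, map_smul]
  jacobi := by
    rintro i j _ _ ⟨x, hx, rfl⟩ ⟨y, hy, rfl⟩ z
    obtain ⟨z, rfl⟩ := I.mkQ_surjective z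
    simp only [quotientBracket_mkQ]
    rw [𝔤.jacobi hx hy, map_add, map_smul]

/-- A module over the Lie superalgebra `𝔤`, with underlying vector space `V`. -/
structure Rep (𝔤 : LieSuperalgebra F L) (V : Type*) [AddCommGroup V] [Module F V] where
  grading : SuperGrading F V
  act : L →ₗ[F] V →ₗ[F] V
  act_mem : ∀ {i j : ZMod 2} {x : L} {v : V}, x ∈ 𝔤.grading.part i → v ∈ grading.part j →
    act x v ∈ grading.part (i + j)
  act_bracket : ∀ {i j : ZMod 2} {x y : L}, x ∈ 𝔤.grading.part i → y ∈ 𝔤.grading.part j →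
    ∀ v : V, act (𝔤.bracket x y) v = act x (act y v) - koszulSign F i j • act y (act x v)

/-- The adjoint module. -/
def adjointRep (𝔤 : LieSuperalgebra F L) : 𝔤.Rep L where
  grading := 𝔤.grading
  act := 𝔤.bracket
  act_mem := 𝔤.bracket_mem
  act_bracket hx hy v := by rw [𝔤.jacobi hx hy, add_sub_cancel_right]

/-- The (one-dimensional, even) trivial module. -/
def trivialRep (𝔤 : LieSuperalgebra F L) : 𝔤.Rep F where
  grading :=
    { part := fun i => if i = 0 then ⊤ else ⊥
      isCompl := by simpa using isCompl_top_bot }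
  act := 0
  act_mem _ _ := by simp
  act_bracket _ _ v := by simp

namespace Rep

variable {𝔤 : LieSuperalgebra F L} {V W : Type*} [AddCommGroup V] [Module F V]
  [AddCommGroup W] [Module F W]

/-- The same action on the space with the two parities exchanged. -/
def parityChange (ρ : 𝔤.Rep V) : 𝔤.Rep V where
  grading := ρ.grading.parityChange
  act := ρ.act
  act_mem {i j x v} hx hv := by
    have h := ρ.act_mem (j := j + 1) hx hv
    rw [← add_assoc] at h
    exact h
  act_bracket := ρ.act_bracket

/-- Isomorphism of `𝔤`-modules, by an even (parity-preserving) linear bijection. -/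
def IsIso (ρ : 𝔤.Rep V) (σ : 𝔤.Rep W) : Prop :=
  ∃ e : V ≃ₗ[F] W, (∀ i, ∀ v ∈ ρ.grading.part i, e v ∈ σ.grading.part i) ∧
    ∀ x v, e (ρ.act x v) = σ.act x (e v)

/-- Irreducibility: the module is nonzero and has no proper nonzero graded submodule. -/
def IsIrreducible (ρ : 𝔤.Rep V) : Prop :=
  Nontrivial V ∧ ∀ W : Submodule F V, ρ.grading.IsGraded W →
    (∀ x, ∀ v ∈ W, ρ.act x v ∈ W) → W = ⊥ ∨ W = ⊤

/-- The weight space `V_μ = {v | h.v = μ(h) v for all h ∈ 𝔥}`. -/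
def weightSpace (ρ : 𝔤.Rep V) (𝔥 : Submodule F L) (μ : Module.Dual F 𝔥) : Submodule F V where
  carrier := {v | ∀ h : 𝔥, ρ.act h.1 v = μ h • v}
  add_mem' ha hb h := by simp [ha h, hb h]
  zero_mem' h := by simp
  smul_mem' c v hv h := by simp [hv h, smul_comm c]

/-- `V` is the sum of its weight spaces relative to `𝔥`, and all its weights lie in `S`. -/
def HasWeightsIn (ρ : 𝔤.Rep V) (𝔥 : Submodule F L) (S : Set (Module.Dual F 𝔥)) : Prop :=
  (⨆ μ, ρ.weightSpace 𝔥 μ) = ⊤ ∧ ∀ μ, ρ.weightSpace 𝔥 μ ≠ ⊥ → μ ∈ S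

end Rep

/-- The roots of `𝔤` relative to `𝔥`: the nonzero weights of the adjoint module. -/
def roots (𝔤 : LieSuperalgebra F L) (𝔥 : Submodule F L) : Set (Module.Dual F 𝔥) :=
  {μ | μ ≠ 0 ∧ 𝔤.adjointRep.weightSpace 𝔥 μ ≠ ⊥}

end LieSuperalgebra

namespace TypeA

/-- The parity of an index of an `((m+1)+(n+1)) × ((m+1)+(n+1))` block matrix. -/
def parity {m n : ℕ} : Fin (m + 1) ⊕ Fin (n + 1) → ZMod 2 :=
  Sum.elim (fun _ => 0) (fun _ => 1)

variable (F : Type*) [Field F] (m n : ℕ)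

/-- The `((m+1)+(n+1)) × ((m+1)+(n+1))` matrices. -/
abbrev Mat := Matrix (Fin (m + 1) ⊕ Fin (n + 1)) (Fin (m + 1) ⊕ Fin (n + 1)) F

/-- Even matrices are block diagonal, odd matrices have zero diagonal blocks. -/
def matPart (k : ZMod 2) : Submodule F (Mat F m n) where
  carrier := {A | ∀ i j, parity i + parity j ≠ k → A i j = 0}
  add_mem' ha hb i j h := by simp [ha i j h, hb i j h]
  zero_mem' i j _ := rfl
  smul_mem' c A hA i j h := by simp [hA i j h]

/-- The projection onto the block diagonal matrices. -/
def evenPart : Mat F m n →ₗ[F] Mat F m n where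
  toFun A := Matrix.of fun i j => if parity i = parity j then A i j else 0
  map_add' A B := by ext i j; by_cases h : parity i = parity j <;> simp [h]
  map_smul' c A := by ext i j; by_cases h : parity i = parity j <;> simp [h]

/-- The projection onto the matrices with zero diagonal blocks. -/
def oddPart : Mat F m n →ₗ[F] Mat F m n where
  toFun A := Matrix.of fun i j => if parity i = parity j then 0 else A i j
  map_add' A B := by ext i j; by_cases h : parity i = parity j <;> simp [h]
  map_smul' c A := by ext i j; by_cases h : parity i = parity j <;> simp [h]

theorem even_add_odd (A : Mat F m n) : evenPart F m n A + oddPart F m n A = A := by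
  ext i j; by_cases h : parity i = parity j <;> simp [evenPart, oddPart, h]

theorem zmod2_add_eq (a b : ZMod 2) : a + b = 0 ↔ a = b := by
  revert a b; decide

theorem zmod2_add_eq_one (a b : ZMod 2) : a + b = 1 ↔ a ≠ b := by
  revert a b; decide

theorem evenPart_mem (A : Mat F m n) : evenPart F m n A ∈ matPart F m n 0 := by
  intro i j h
  rw [ne_eq, zmod2_add_eq] at h
  simp [evenPart, h]

theorem oddPart_mem (A : Mat F m n) : oddPart F m n A ∈ matPart F m n 1 := by
  intro i j h
  rw [ne_eq, zmod2_add_eq_one, not_not] at h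
  simp [oddPart, h]

/-- The grading of the matrices. -/
def matGrading : SuperGrading F (Mat F m n) where
  part := matPart F m n
  isCompl := by
    constructor
    · rw [Submodule.disjoint_def]
      intro A h0 h1
      ext i j
      by_cases h : parity i = parity j
      · exact h1 i j (by rw [ne_eq, zmod2_add_eq_one, not_not]; exact h)
      · exact h0 i j (by rw [ne_eq, zmod2_add_eq]; exact h)
    · rw [codisjoint_iff, eq_top_iff]
      intro A _
      exact Submodule.mem_sup.2 ⟨_, evenPart_mem F m n A, _, oddPart_mem F m n A,
        even_add_odd F m n A⟩

/-- The supercommutator, i.e. the bilinear map with `[A, B] = AB - (-1)^{ij} BA` for homogeneous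
`A`, `B` of parities `i`, `j` (see `superBracket_of_mem`). -/
def superBracket : Mat F m n →ₗ[F] Mat F m n →ₗ[F] Mat F m n :=
  LinearMap.mk₂ F
    (fun A B => A * B - B * A + (2 : F) • (oddPart F m n B * oddPart F m n A))
    (fun A A' B => by simp only [map_add, add_mul, mul_add, smul_add]; abel)
    (fun c A B => by simp [smul_sub, smul_comm c])
    (fun A B B' => by simp only [map_add, add_mul, mul_add, smul_add]; abel)
    (fun c A B => by simp [smul_sub, smul_comm c])

theorem oddPart_of_even {A : Mat F m n} (hA : A ∈ matPart F m n 0) : oddPart F m n A = 0 := by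
  ext i j
  by_cases h : parity i = parity j
  · simp [oddPart, h]
  · simpa [oddPart, h] using hA i j (by rw [ne_eq, zmod2_add_eq]; exact h)

theorem oddPart_of_odd {A : Mat F m n} (hA : A ∈ matPart F m n 1) : oddPart F m n A = A := by
  ext i j
  by_cases h : parity i = parity j
  · simpa [oddPart, h] using (hA i j (by rw [ne_eq, zmod2_add_eq_one, not_not]; exact h)).symm
  · simp [oddPart, h]

theorem superBracket_of_mem {i j : ZMod 2} {A B : Mat F m n} (hA : A ∈ matPart F m n i)
    (hB : B ∈ matPart F m n j) : superBracket F m n A B = A * B - koszulSign F i j • (B * A) := by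
  have h01 : ∀ k : ZMod 2, k = 0 ∨ k = 1 := by decide
  rcases h01 i with rfl | rfl <;> rcases h01 j with rfl | rfl
  · simp [superBracket, koszulSign, oddPart_of_even F m n hA]
  · simp [superBracket, koszulSign, oddPart_of_even F m n hA]
  · simp [superBracket, koszulSign, oddPart_of_even F m n hB]
  · simp only [superBracket, koszulSign, LinearMap.mk₂_apply, oddPart_of_odd F m n hA,
      oddPart_of_odd F m n hB, and_self, if_true, two_smul, neg_smul, one_smul]
    abel

theorem mul_mem_matPart {i j : ZMod 2} {A B : Mat F m n} (hA : A ∈ matPart F m n i)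
    (hB : B ∈ matPart F m n j) : A * B ∈ matPart F m n (i + j) := by
  intro a b hab
  rw [Matrix.mul_apply]
  refine Finset.sum_eq_zero fun c _ => ?_
  by_cases h1 : parity a + parity c = i
  · by_cases h2 : parity c + parity b = j
    · refine absurd ?_ hab
      rw [← h1, ← h2]
      generalize parity a = x
      generalize parity b = y
      generalize parity c = z
      revert x y z
      decide
    · rw [hB c b h2, mul_zero]
  · rw [hA a c h1, zero_mul]

theorem superBracket_mem {i j : ZMod 2} {A B : Mat F m n} (hA : A ∈ matPart F m n i)
    (hB : B ∈ matPart F m n j) : superBracket F m n A B ∈ matPart F m n (i + j) := by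
  rw [superBracket_of_mem F m n hA hB]
  refine sub_mem (mul_mem_matPart F m n hA hB) (Submodule.smul_mem _ _ ?_)
  rw [add_comm i j]
  exact mul_mem_matPart F m n hB hA

/-- The general linear Lie superalgebra. -/
def gl : LieSuperalgebra F (Mat F m n) where
  grading := matGrading F m n
  bracket := superBracket F m n
  bracket_mem := superBracket_mem F m n
  skew {i j A B} hA hB := by
    rw [superBracket_of_mem F m n hA hB, superBracket_of_mem F m n hB hA]
    have h01 : ∀ k : ZMod 2, k = 0 ∨ k = 1 := by decide
    rcases h01 i with rfl | rfl <;> rcases h01 j with rfl | rfl <;>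
      simp [koszulSign, add_comm]
  jacobi {i j A B} hA hB C := by
    have key : ∀ {k : ZMod 2} {C : Mat F m n}, C ∈ matPart F m n k →
        superBracket F m n A (superBracket F m n B C) =
          superBracket F m n (superBracket F m n A B) C +
            koszulSign F i j • superBracket F m n B (superBracket F m n A C) := by
      intro k C hC
      rw [superBracket_of_mem F m n hA (superBracket_mem F m n hB hC),
        superBracket_of_mem F m n (superBracket_mem F m n hA hB) hC,
        superBracket_of_mem F m n hB (superBracket_mem F m n hA hC),
        superBracket_of_mem F m n hA hB, superBracket_of_mem F m n hB hC,
        superBracket_of_mem F m n hA hC]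
      have h01 : ∀ k : ZMod 2, k = 0 ∨ k = 1 := by decide
      have h2 : (1 + 1 : ZMod 2) = 0 := by decide
      rcases h01 i with rfl | rfl <;> rcases h01 j with rfl | rfl <;>
        rcases h01 k with rfl | rfl <;>
        simp [koszulSign, h2] <;> noncomm_ring
    have hC := even_add_odd F m n C
    rw [← hC]
    simp only [map_add, smul_add]
    rw [key (evenPart_mem F m n C), key (oddPart_mem F m n C)]
    abel

/-- The supertrace. -/
def supertrace : Mat F m n →ₗ[F] F where
  toFun A := ∑ i, A (Sum.inl i) (Sum.inl i) - ∑ r, A (Sum.inr r) (Sum.inr r)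
  map_add' A B := by simp [Finset.sum_add_distrib]; ring
  map_smul' c A := by simp [mul_sub, Finset.mul_sum]

theorem supertrace_eq_sum (A : Mat F m n) :
    supertrace F m n A = ∑ i, (if parity i = 0 then (1 : F) else -1) * A i i := by
  simp [supertrace, parity, Fintype.sum_sum_type, sub_eq_add_neg]

theorem supertrace_superBracket (A B : Mat F m n) :
    supertrace F m n (superBracket F m n A B) = 0 := by
  have h : superBracket F m n A B =
      A * B - B * A + (2 : F) • (oddPart F m n B * oddPart F m n A) := rfl
  rw [h, map_add, map_sub, map_smul, supertrace_eq_sum, supertrace_eq_sum, supertrace_eq_sum]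
  simp only [Matrix.mul_apply, Finset.mul_sum, smul_eq_mul]
  rw [Finset.sum_comm, ← Finset.sum_sub_distrib, ← Finset.sum_add_distrib]
  refine Finset.sum_eq_zero fun i _ => ?_
  rw [← Finset.sum_sub_distrib, ← Finset.sum_add_distrib]
  refine Finset.sum_eq_zero fun j _ => ?_
  have h01 : ∀ k : ZMod 2, k = 0 ∨ k = 1 := by decide
  rcases h01 (parity i) with hi | hi <;> rcases h01 (parity j) with hj | hj <;>
    simp [oddPart, hi, hj] <;> ring

/-- The subspace of matrices of supertrace zero. -/
def slSpace : Submodule F (Mat F m n) := LinearMap.ker (supertrace F m n)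

theorem slSpace_isGraded : (gl F m n).grading.IsGraded (slSpace F m n) := by
  have hodd : ∀ A : Mat F m n, oddPart F m n A ∈ slSpace F m n := by
    intro A
    simp [slSpace, LinearMap.mem_ker, supertrace, oddPart]
  intro A hA
  refine Submodule.mem_sup.2 ⟨evenPart F m n A, ⟨?_, evenPart_mem F m n A⟩,
    oddPart F m n A, ⟨hodd A, oddPart_mem F m n A⟩, even_add_odd F m n A⟩
  have h : evenPart F m n A = A - oddPart F m n A := eq_sub_of_add_eq (even_add_odd F m n A)
  rw [h]
  exact sub_mem hA (hodd A)

/-- The special linear Lie superalgebra `sl(m+1, n+1)`. -/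
def sl : LieSuperalgebra F (slSpace F m n) :=
  (gl F m n).subalgebra (slSpace F m n) (slSpace_isGraded F m n)
    (fun A _ B _ => LinearMap.mem_ker.2 (supertrace_superBracket F m n A B))

/-- The scalar matrices in `sl(m+1, n+1)`; in characteristic `0` these are all the scalar matrices
if `m = n`, and only `0` if `m ≠ n`. -/
def scalars : Submodule F (slSpace F m n) :=
  (Submodule.span F {(1 : Mat F m n)}).comap (slSpace F m n).subtype

theorem scalar_mem_even (c : F) : c • (1 : Mat F m n) ∈ matPart F m n 0 := by
  intro i j h
  have : i ≠ j := by
    rintro rfl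
    exact h ((zmod2_add_eq _ _).2 rfl)
  simp [Matrix.one_apply_ne this]

theorem scalars_isGraded : (sl F m n).grading.IsGraded (scalars F m n) := by
  intro A hA
  refine Submodule.mem_sup_left ⟨hA, ?_⟩
  obtain ⟨c, hc⟩ := Submodule.mem_span_singleton.1 hA
  have h := scalar_mem_even F m n c
  rw [hc] at h
  exact h

theorem bracket_scalar_left {A : slSpace F m n} (hA : A ∈ scalars F m n) (B : slSpace F m n) :
    (sl F m n).bracket A B = 0 := by
  obtain ⟨c, hc⟩ := Submodule.mem_span_singleton.1 hA
  have h0 : oddPart F m n (c • (1 : Mat F m n)) = 0 :=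
    oddPart_of_even F m n (scalar_mem_even F m n c)
  refine Subtype.ext ?_
  change superBracket F m n ((slSpace F m n).subtype A) B.1 = 0
  rw [← hc]
  simp only [superBracket, LinearMap.mk₂_apply, h0]
  simp

theorem bracket_scalar_right (A : slSpace F m n) {B : slSpace F m n} (hB : B ∈ scalars F m n) :
    (sl F m n).bracket A B = 0 := by
  obtain ⟨c, hc⟩ := Submodule.mem_span_singleton.1 hB
  have h0 : oddPart F m n (c • (1 : Mat F m n)) = 0 :=
    oddPart_of_even F m n (scalar_mem_even F m n c)
  refine Subtype.ext ?_
  change superBracket F m n A.1 ((slSpace F m n).subtype B) = 0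
  rw [← hc]
  simp only [superBracket, LinearMap.mk₂_apply, h0]
  simp

/-- The Lie superalgebra of type `A(m, n)`: the quotient of `sl(m+1, n+1)` by its scalar matrices,
i.e. `sl(m+1, n+1)` itself if `m ≠ n` and `psl(n+1, n+1)` if `m = n`. -/
def A : LieSuperalgebra F (slSpace F m n ⧸ scalars F m n) :=
  (sl F m n).quotient (scalars F m n) (scalars_isGraded F m n)
    (fun x hx y => by rw [bracket_scalar_left F m n hx y]; exact zero_mem _)
    (fun x y hy => by rw [bracket_scalar_right F m n x hy]; exact zero_mem _)

/-- The Cartan subalgebra of diagonal matrices (modulo the scalar matrices). -/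
def cartan : Submodule F (slSpace F m n ⧸ scalars F m n) :=
  Submodule.map (scalars F m n).mkQ
    { carrier := {D : slSpace F m n | D.1.IsDiag}
      add_mem' := fun ha hb => Matrix.IsDiag.add ha hb
      zero_mem' := Matrix.isDiag_zero
      smul_mem' := fun c _ hD => Matrix.IsDiag.smul c hD }

end TypeA

/-! The proof distinguishes whether some even root is a weight of the module.

Suppose α = ε_i - ε_j is an even root and a weight. Its coroot h = E_ii - E_jj takes integer values
at most 2 on Δ ∪ {0}, and the value 2 only at α (`exists_weight_value`). Hence a vector v of weight
α is extremal: root vectors on which h is nonnegative kill v, and those on which h is negative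
preserve the sum of the other weight spaces, which does not contain v. The usual uniqueness argument
for highest weight modules then applies (`isIso_of_highest`). For two such modules with vectors v
and w, the submodule of the direct sum generated by (v, w) contains neither (v, 0) nor (0, w), so by
irreducibility it is the graph of an isomorphism. The adjoint module, irreducible by
`adjointRep_isIrreducible`, has E_ij as such a vector, so the module is adjoint up to parity.
One-dimensionality of V_α is never needed.

Suppose no even root is a weight. If an odd root μ were a weight, there would be an odd root β with
μ + β an even root and μ nonzero on the coroot of β; then μ - β would be a weight, but it is neither
zero nor an odd root (`odd_root_weightSpace_eq_bot`). So 0 is the only weight, the algebra acts by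
zero, and irreducibility makes the module trivial up to parity.

For m = n the functionals ε_a - ε_b satisfy extra relations (in A(1,1) distinct pairs of indices can
give the same odd root), so weights are compared by evaluating on coroots. -/

theorem zmod_two_cases (k : ZMod 2) : k = 0 ∨ k = 1 := by
  revert k; decide

/-! ### Homogeneous components and graded parts of subspaces -/

namespace SuperGrading

variable {F V : Type*} [Field F] [AddCommGroup V] [Module F V]

theorem exists_add (G : SuperGrading F V) (v : V) :
    ∃ a ∈ G.part 0, ∃ b ∈ G.part 1, a + b = v :=
  Submodule.mem_sup.1 (codisjoint_iff.1 G.isCompl.codisjoint ▸ Submodule.mem_top (x := v))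

theorem eq_zero_of_mem (G : SuperGrading F V) {v : V} (h0 : v ∈ G.part 0) (h1 : v ∈ G.part 1) :
    v = 0 :=
  Submodule.disjoint_def.1 G.isCompl.disjoint v h0 h1

theorem add_eq_add (G : SuperGrading F V) {a a' b b' : V} (ha : a ∈ G.part 0)
    (ha' : a' ∈ G.part 0) (hb : b ∈ G.part 1) (hb' : b' ∈ G.part 1) (h : a + b = a' + b') :
    a = a' ∧ b = b' := by
  have h1 : a - a' = b' - b := by
    rw [sub_eq_sub_iff_add_eq_add, h, add_comm]
  have h2 : a - a' = 0 :=
    G.eq_zero_of_mem (sub_mem ha ha') (h1 ▸ sub_mem hb' hb)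
  refine ⟨sub_eq_zero.1 h2, ?_⟩
  rw [h1] at h2
  exact (sub_eq_zero.1 h2).symm

/-- The largest graded subspace of `W`. -/
def gradedPart (G : SuperGrading F V) (W : Submodule F V) : Submodule F V :=
  (W ⊓ G.part 0) ⊔ (W ⊓ G.part 1)

theorem gradedPart_le (G : SuperGrading F V) (W : Submodule F V) : G.gradedPart W ≤ W :=
  sup_le inf_le_left inf_le_left

theorem gradedPart_isGraded (G : SuperGrading F V) (W : Submodule F V) :
    G.IsGraded (G.gradedPart W) :=
  sup_le_sup (le_inf le_sup_left inf_le_right) (le_inf le_sup_right inf_le_right)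

theorem mem_gradedPart (G : SuperGrading F V) {W : Submodule F V} {i : ZMod 2} {v : V}
    (hv : v ∈ W) (hi : v ∈ G.part i) : v ∈ G.gradedPart W := by
  rcases zmod_two_cases i with rfl | rfl
  · exact Submodule.mem_sup_left ⟨hv, hi⟩
  · exact Submodule.mem_sup_right ⟨hv, hi⟩

end SuperGrading

/-! ### Uniqueness of irreducible modules with an extremal vector -/

namespace LieSuperalgebra.Rep

variable {F L : Type*} [Field F] [AddCommGroup L] [Module F L] {𝔤 : LieSuperalgebra F L}
  {V W : Type*} [AddCommGroup V] [Module F V] [AddCommGroup W] [Module F W]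

theorem act_act (ρ : 𝔤.Rep V) {i j : ZMod 2} {x y : L} (hx : x ∈ 𝔤.grading.part i)
    (hy : y ∈ 𝔤.grading.part j) (v : V) :
    ρ.act x (ρ.act y v) = ρ.act (𝔤.bracket x y) v + koszulSign F i j • ρ.act y (ρ.act x v) := by
  rw [ρ.act_bracket hx hy, sub_add_cancel]

theorem act_mem_gradedPart (ρ : 𝔤.Rep V) {U : Submodule F V} (hU : ∀ x, ∀ v ∈ U, ρ.act x v ∈ U)
    (x : L) {v : V} (hv : v ∈ ρ.grading.gradedPart U) : ρ.act x v ∈ ρ.grading.gradedPart U := by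
  obtain ⟨x₀, hx₀, x₁, hx₁, rfl⟩ := 𝔤.grading.exists_add x
  obtain ⟨v₀, hv₀, v₁, hv₁, rfl⟩ := Submodule.mem_sup.1 hv
  have key : ∀ {i j : ZMod 2} {y : L} {w : V}, y ∈ 𝔤.grading.part i →
      w ∈ U ⊓ ρ.grading.part j → ρ.act y w ∈ ρ.grading.gradedPart U := fun hy hw =>
    ρ.grading.mem_gradedPart (hU _ _ hw.1) (ρ.act_mem hy hw.2)
  simp only [map_add, LinearMap.add_apply]
  exact add_mem (add_mem (key hx₀ hv₀) (key hx₁ hv₀)) (add_mem (key hx₀ hv₁) (key hx₁ hv₁))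

/-- If `𝔤` is spanned by homogeneous elements which either preserve the line through the
homogeneous vector `v` or preserve a subspace `P ∋ v`, then `P` contains a graded submodule
through `v`. -/
theorem exists_graded_submodule (ρ : 𝔤.Rep V) {S T : Set L}
    (hS : ∀ a ∈ S, ∃ i, a ∈ 𝔤.grading.part i) (hT : ∀ a ∈ T, ∃ i, a ∈ 𝔤.grading.part i)
    (hST : Submodule.span F (S ∪ T) = ⊤) {i : ZMod 2} {v : V} (hv : v ∈ ρ.grading.part i)
    (hSv : ∀ a ∈ S, ∃ c : F, ρ.act a v = c • v) {P : Submodule F V} (hvP : v ∈ P)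
    (hTP : ∀ b ∈ T, ∀ y ∈ P, ρ.act b y ∈ P) :
    ∃ U : Submodule F V, v ∈ U ∧ U ≤ P ∧ ρ.grading.IsGraded U ∧
      ∀ x, ∀ y ∈ U, ρ.act x y ∈ U := by
  -- The smallest `T`-stable subspace through `v` lies in `P`; it turns out to be stable under all
  -- of `𝔤`.
  set U : Submodule F V := sInf {U | v ∈ U ∧ ∀ b ∈ T, ∀ y ∈ U, ρ.act b y ∈ U} with hU
  have hvU : v ∈ U := Submodule.mem_sInf.2 fun _ h => h.1
  have hTU : ∀ b ∈ T, ∀ y ∈ U, ρ.act b y ∈ U := fun b hb y hy =>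
    Submodule.mem_sInf.2 fun Q hQ => hQ.2 b hb y (Submodule.mem_sInf.1 hy Q hQ)
  -- The vectors of `U` that `S` keeps in `U`. Once `U'` is known to be `T`-stable, minimality gives
  -- `U ≤ U'`.
  set U' : Submodule F V := U ⊓ ⨅ a ∈ S, U.comap (ρ.act a) with hU'
  have mem_U' : ∀ y, y ∈ U' ↔ y ∈ U ∧ ∀ a ∈ S, ρ.act a y ∈ U := fun y => by
    simp [hU', Submodule.mem_iInf]
  have all : ∀ x, ∀ y ∈ U', ρ.act x y ∈ U := fun x y hy => by
    rw [mem_U'] at hy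
    have hx : x ∈ Submodule.span F (S ∪ T) := hST ▸ Submodule.mem_top
    induction hx using Submodule.span_induction with
    | mem z hz => exact hz.elim (fun h => hy.2 z h) (fun h => hTU z h y hy.1)
    | zero => simp
    | add a b _ _ ha hb => simpa using add_mem ha hb
    | smul c a _ ha => simpa using U.smul_mem c ha
  have hUU' : U ≤ U' := by
    refine sInf_le ⟨(mem_U' v).2 ⟨hvU, fun a ha => ?_⟩, fun b hb y hy => (mem_U' _).2
      ⟨hTU b hb y ((mem_U' y).1 hy).1, fun a ha => ?_⟩⟩
    · obtain ⟨c, hc⟩ := hSv a ha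
      exact hc ▸ U.smul_mem c hvU
    -- Here a(by) = [a,b]y ± b(ay). The bracket [a,b] is an arbitrary element of the span of `S ∪
    -- T`, which still sends y into `U`, so no closure of `S` or `T` under brackets is required.
    · obtain ⟨k, hk⟩ := hS a ha
      obtain ⟨l, hl⟩ := hT b hb
      rw [ρ.act_act hk hl]
      exact add_mem (all _ y hy) (U.smul_mem _ (hTU b hb _ (((mem_U' y).1 hy).2 a ha)))
  exact ⟨ρ.grading.gradedPart U, ρ.grading.mem_gradedPart hvU hv,
    (ρ.grading.gradedPart_le U).trans (sInf_le ⟨hvP, hTP⟩), ρ.grading.gradedPart_isGraded U,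
    fun x y hy => ρ.act_mem_gradedPart (fun x y hy => all x y (hUU' hy)) x hy⟩

/-- The direct sum of two modules. -/
def prod (ρ : 𝔤.Rep V) (σ : 𝔤.Rep W) : 𝔤.Rep (V × W) where
  grading :=
    { part := fun i => (ρ.grading.part i).prod (σ.grading.part i)
      isCompl := by
        constructor
        · rw [Submodule.disjoint_def]
          rintro ⟨a, b⟩ ⟨ha, hb⟩ ⟨ha', hb'⟩
          exact Prod.ext (ρ.grading.eq_zero_of_mem ha ha') (σ.grading.eq_zero_of_mem hb hb')
        · rw [codisjoint_iff, eq_top_iff]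
          rintro ⟨a, b⟩ -
          obtain ⟨a₀, ha₀, a₁, ha₁, rfl⟩ := ρ.grading.exists_add a
          obtain ⟨b₀, hb₀, b₁, hb₁, rfl⟩ := σ.grading.exists_add b
          exact Submodule.mem_sup.2 ⟨(a₀, b₀), ⟨ha₀, hb₀⟩, (a₁, b₁), ⟨ha₁, hb₁⟩, rfl⟩ }
  act := LinearMap.mk₂ F (fun x p => (ρ.act x p.1, σ.act x p.2)) (by simp) (by simp) (by simp)
    (by simp)
  act_mem hx hv := ⟨ρ.act_mem hx hv.1, σ.act_mem hx hv.2⟩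
  act_bracket hx hy v := Prod.ext (ρ.act_bracket hx hy v.1) (σ.act_bracket hx hy v.2)

theorem prod_act (ρ : 𝔤.Rep V) (σ : 𝔤.Rep W) (x : L) (p : V × W) :
    (ρ.prod σ).act x p = (ρ.act x p.1, σ.act x p.2) := rfl

/-- Two irreducible modules related by a graded submodule `U` of their sum which is neither zero
on one of the sides nor contains one of them are isomorphic: `U` is the graph of an isomorphism. -/
theorem isIso_of_graph {ρ : 𝔤.Rep V} {σ : 𝔤.Rep W} (hρ : ρ.IsIrreducible) (hσ : σ.IsIrreducible)
    {U : Submodule F (V × W)} (hg : (ρ.prod σ).grading.IsGraded U)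
    (hU : ∀ x, ∀ y ∈ U, (ρ.prod σ).act x y ∈ U) {v : V} {w : W} (hvw : (v, w) ∈ U)
    (hv : (v, 0) ∉ U) (hw : (0, w) ∉ U) : ρ.IsIso σ := by
  have split : ∀ {a b}, (a, b) ∈ U → ∃ a₀ b₀ a₁ b₁, (a₀, b₀) ∈ U ∧ (a₁, b₁) ∈ U ∧
      a₀ ∈ ρ.grading.part 0 ∧ b₀ ∈ σ.grading.part 0 ∧ a₁ ∈ ρ.grading.part 1 ∧
      b₁ ∈ σ.grading.part 1 ∧ a₀ + a₁ = a ∧ b₀ + b₁ = b := by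
    intro a b h
    obtain ⟨⟨a₀, b₀⟩, ⟨h0, ha₀, hb₀⟩, ⟨a₁, b₁⟩, ⟨h1, ha₁, hb₁⟩, hab⟩ := Submodule.mem_sup.1 (hg h)
    rw [Prod.mk_add_mk, Prod.mk.injEq] at hab
    exact ⟨a₀, b₀, a₁, b₁, h0, h1, ha₀, hb₀, ha₁, hb₁, hab.1, hab.2⟩
  -- The a with (a, 0) in `U` form a graded submodule of `V` that misses `v`.
  have inl : ∀ a, (a, 0) ∈ U → a = 0 := by
    have := (hρ.2 (U.comap (LinearMap.inl F V W)) ?_ ?_).resolve_right ?_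
    · intro a ha
      exact (Submodule.eq_bot_iff _).1 this a ha
    · intro a ha
      obtain ⟨a₀, b₀, a₁, b₁, h0, h1, ha₀, hb₀, ha₁, hb₁, hab, hb⟩ := split ha
      obtain ⟨rfl, rfl⟩ := σ.grading.add_eq_add hb₀ (zero_mem _) hb₁ (zero_mem _)
        (hb.trans (add_zero 0).symm)
      exact Submodule.mem_sup.2 ⟨a₀, ⟨h0, ha₀⟩, a₁, ⟨h1, ha₁⟩, hab⟩
    · intro x a ha
      have := hU x _ ha
      simpa [prod_act] using this
    · intro h
      exact hv ((Submodule.eq_top_iff'.1 h) v)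
  have inr : ∀ b, (0, b) ∈ U → b = 0 := by
    have := (hσ.2 (U.comap (LinearMap.inr F V W)) ?_ ?_).resolve_right ?_
    · intro a ha
      exact (Submodule.eq_bot_iff _).1 this a ha
    · intro a ha
      obtain ⟨a₀, b₀, a₁, b₁, h0, h1, ha₀, hb₀, ha₁, hb₁, ha, hab⟩ := split ha
      obtain ⟨rfl, rfl⟩ := ρ.grading.add_eq_add ha₀ (zero_mem _) ha₁ (zero_mem _)
        (ha.trans (add_zero 0).symm)
      exact Submodule.mem_sup.2 ⟨b₀, ⟨h0, hb₀⟩, b₁, ⟨h1, hb₁⟩, hab⟩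
    · intro x a ha
      have := hU x _ ha
      simpa [prod_act] using this
    · intro h
      exact hw ((Submodule.eq_top_iff'.1 h) w)
  -- The projection of `U` is a graded submodule containing `v`, and `v` is nonzero because (0, 0)
  -- lies in `U`.
  have fst : ∀ a, ∃ b, (a, b) ∈ U := by
    have := (hρ.2 (U.map (LinearMap.fst F V W)) ?_ ?_).resolve_left ?_
    · intro a
      obtain ⟨⟨_, b⟩, h, rfl⟩ := (Submodule.eq_top_iff'.1 this) a
      exact ⟨b, h⟩
    · rintro _ ⟨⟨a, b⟩, h, rfl⟩
      obtain ⟨a₀, b₀, a₁, b₁, h0, h1, ha₀, hb₀, ha₁, hb₁, ha, hb⟩ := split h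
      exact Submodule.mem_sup.2 ⟨a₀, ⟨⟨_, h0, rfl⟩, ha₀⟩, a₁, ⟨⟨_, h1, rfl⟩, ha₁⟩, ha⟩
    · rintro x _ ⟨p, h, rfl⟩
      exact ⟨_, hU x _ h, rfl⟩
    · intro h
      have hv0 : v = 0 := (Submodule.eq_bot_iff _).1 h v ⟨_, hvw, rfl⟩
      exact hv (by rw [hv0]; exact zero_mem U)
  have snd : ∀ b, ∃ a, (a, b) ∈ U := by
    have := (hσ.2 (U.map (LinearMap.snd F V W)) ?_ ?_).resolve_left ?_
    · intro b
      obtain ⟨⟨a, _⟩, h, rfl⟩ := (Submodule.eq_top_iff'.1 this) b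
      exact ⟨a, h⟩
    · rintro _ ⟨⟨a, b⟩, h, rfl⟩
      obtain ⟨a₀, b₀, a₁, b₁, h0, h1, ha₀, hb₀, ha₁, hb₁, ha, hb⟩ := split h
      exact Submodule.mem_sup.2 ⟨b₀, ⟨⟨_, h0, rfl⟩, hb₀⟩, b₁, ⟨⟨_, h1, rfl⟩, hb₁⟩, hb⟩
    · rintro x _ ⟨p, h, rfl⟩
      exact ⟨_, hU x _ h, rfl⟩
    · intro h
      have hw0 : w = 0 := (Submodule.eq_bot_iff _).1 h w ⟨_, hvw, rfl⟩
      exact hw (by rw [hw0]; exact zero_mem U)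
  choose f hf using fst
  have uniq : ∀ {a b b'}, (a, b) ∈ U → (a, b') ∈ U → b = b' := fun h h' =>
    sub_eq_zero.1 (inr _ (by simpa using sub_mem h h'))
  let φ : V →ₗ[F] W :=
    { toFun := f
      map_add' := fun a b => uniq (hf _) (by simpa using add_mem (hf a) (hf b))
      map_smul' := fun c a => uniq (hf _) (by simpa using U.smul_mem c (hf a)) }
  have hφ : Function.Bijective φ := by
    constructor
    · refine (injective_iff_map_eq_zero φ).2 fun a ha => inl a ?_
      have := hf a
      rwa [show f a = 0 from ha] at this
    · intro b
      obtain ⟨a, ha⟩ := snd b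
      exact ⟨a, uniq (hf a) ha⟩
  refine ⟨LinearEquiv.ofBijective φ hφ, fun i a ha => ?_, fun x a => ?_⟩
  · obtain ⟨a₀, b₀, a₁, b₁, h0, h1, ha₀, hb₀, ha₁, hb₁, hab, hb⟩ := split (hf a)
    change f a ∈ σ.grading.part i
    rcases zmod_two_cases i with rfl | rfl
    · obtain ⟨-, rfl⟩ := ρ.grading.add_eq_add ha₀ ha ha₁ (zero_mem _) (by rw [hab, add_zero])
      rw [← hb, inr _ h1, add_zero]
      exact hb₀
    · obtain ⟨rfl, -⟩ := ρ.grading.add_eq_add ha₀ (zero_mem _) ha₁ ha (by rw [hab, zero_add])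
      rw [← hb, inr _ h0, zero_add]
      exact hb₁
  · exact uniq (hf _) (hU x _ (hf a))

/-- Uniqueness of an irreducible module with a given highest weight vector. -/
theorem isIso_of_highest {ρ : 𝔤.Rep V} {σ : 𝔤.Rep W} (hρ : ρ.IsIrreducible)
    (hσ : σ.IsIrreducible) {S T : Set L}
    (hS : ∀ a ∈ S, ∃ i, a ∈ 𝔤.grading.part i) (hT : ∀ a ∈ T, ∃ i, a ∈ 𝔤.grading.part i)
    (hST : Submodule.span F (S ∪ T) = ⊤) {i : ZMod 2} {v : V} (hv : v ∈ ρ.grading.part i)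
    {w : W} (hw : w ∈ σ.grading.part i)
    (hSvw : ∀ a ∈ S, ∃ c : F, ρ.act a v = c • v ∧ σ.act a w = c • w)
    {V' : Submodule F V} {W' : Submodule F W} (hvV' : v ∉ V') (hwW' : w ∉ W')
    (hTv : ∀ b ∈ T, ρ.act b v ∈ V') (hTw : ∀ b ∈ T, σ.act b w ∈ W')
    (hTV' : ∀ b ∈ T, ∀ y ∈ V', ρ.act b y ∈ V') (hTW' : ∀ b ∈ T, ∀ y ∈ W', σ.act b y ∈ W') :
    ρ.IsIso σ := by
  let P : Submodule F (V × W) := Submodule.span F {(v, w)} ⊔ V'.prod W'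
  have mem_P : ∀ {p}, p ∈ P → ∃ c : F, p.1 - c • v ∈ V' ∧ p.2 - c • w ∈ W' := by
    intro p hp
    obtain ⟨q, hq, r, hr, rfl⟩ := Submodule.mem_sup.1 hp
    obtain ⟨c, rfl⟩ := Submodule.mem_span_singleton.1 hq
    exact ⟨c, by simpa using hr.1, by simpa using hr.2⟩
  have hline : ∀ a ∈ S, ∃ c : F, (ρ.prod σ).act a (v, w) = c • (v, w) := fun a ha => by
    obtain ⟨c, h1, h2⟩ := hSvw a ha
    exact ⟨c, by rw [prod_act, h1, h2, Prod.smul_mk]⟩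
  have hTP : ∀ b ∈ T, ∀ y ∈ P, (ρ.prod σ).act b y ∈ P := fun b hb y hy => by
    obtain ⟨q, hq, r, hr, rfl⟩ := Submodule.mem_sup.1 hy
    obtain ⟨c, rfl⟩ := Submodule.mem_span_singleton.1 hq
    rw [map_add, map_smul]
    exact Submodule.mem_sup_right (add_mem (Submodule.smul_mem _ _ ⟨hTv b hb, hTw b hb⟩)
      ⟨hTV' b hb _ hr.1, hTW' b hb _ hr.2⟩)
  obtain ⟨U, hvU, hUP, hUg, hU⟩ := (ρ.prod σ).exists_graded_submodule hS hT hST (v := (v, w))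
    ⟨hv, hw⟩ hline (Submodule.mem_sup_left (Submodule.mem_span_singleton_self _)) hTP
  refine isIso_of_graph hρ hσ hUg hU hvU (fun h => ?_) (fun h => ?_)
  -- A single scalar c serves both coordinates: c = 0 would put `v` in `V'`, and c ≠ 0 would put `w`
  -- in `W'`.
  · obtain ⟨c, h1, h2⟩ := mem_P (hUP h)
    rcases eq_or_ne c 0 with rfl | hc
    · exact hvV' (by simpa using h1)
    · exact hwW' ((W'.smul_mem_iff hc).1 (by simpa using h2))
  · obtain ⟨c, h1, h2⟩ := mem_P (hUP h)
    rcases eq_or_ne c 0 with rfl | hc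
    · exact hwW' (by simpa using h2)
    · exact hvV' ((V'.smul_mem_iff hc).1 (by simpa using h1))

/-! ### Invariance under isomorphism and parity change; trivial modules; homogeneous weight vectors
-/

theorem isIrreducible_of_isIso {ρ : 𝔤.Rep V} {σ : 𝔤.Rep W} (h : ρ.IsIso σ)
    (hσ : σ.IsIrreducible) : ρ.IsIrreducible := by
  obtain ⟨e, he, hact⟩ := h
  have := hσ.1
  refine ⟨e.toEquiv.nontrivial, fun U hU hUact => ?_⟩
  have := hσ.2 (U.map e.toLinearMap) ?_ ?_
  · rcases this with h | h
    · exact Or.inl (Submodule.map_injective_of_injective (f := e.toLinearMap) e.injective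
        (h.trans (Submodule.map_bot _).symm))
    · refine Or.inr (Submodule.map_injective_of_injective (f := e.toLinearMap) e.injective ?_)
      rw [h, Submodule.map_top, LinearEquiv.range]
  · rintro _ ⟨u, hu, rfl⟩
    obtain ⟨a, ha, b, hb, rfl⟩ := Submodule.mem_sup.1 (hU hu)
    exact Submodule.mem_sup.2 ⟨e a, ⟨⟨a, ha.1, rfl⟩, he _ _ ha.2⟩, e b,
      ⟨⟨b, hb.1, rfl⟩, he _ _ hb.2⟩, by simp⟩
  · rintro x _ ⟨u, hu, rfl⟩
    exact ⟨_, hUact x u hu, hact x u⟩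

theorem map_weightSpace {ρ : 𝔤.Rep V} {σ : 𝔤.Rep W} (e : V ≃ₗ[F] W)
    (he : ∀ x v, e (ρ.act x v) = σ.act x (e v)) (𝔥 : Submodule F L) (μ : Module.Dual F 𝔥) :
    (ρ.weightSpace 𝔥 μ).map e.toLinearMap = σ.weightSpace 𝔥 μ := by
  ext w
  constructor
  · rintro ⟨v, hv, rfl⟩ h
    change σ.act h.1 (e v) = μ h • e v
    rw [← he, hv h, map_smul]
  · intro hw
    refine ⟨e.symm w, fun h => e.injective ?_, e.apply_symm_apply w⟩
    rw [he, map_smul, e.apply_symm_apply, hw h]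

theorem hasWeightsIn_of_isIso {ρ : 𝔤.Rep V} {σ : 𝔤.Rep W} (h : ρ.IsIso σ) {𝔥 : Submodule F L}
    {S : Set (Module.Dual F 𝔥)} (hσ : σ.HasWeightsIn 𝔥 S) : ρ.HasWeightsIn 𝔥 S := by
  obtain ⟨e, -, he⟩ := h
  refine ⟨Submodule.map_injective_of_injective (f := e.toLinearMap) e.injective ?_,
    fun μ hμ => hσ.2 μ fun h => hμ ?_⟩
  · rw [Submodule.map_iSup, Submodule.map_top, LinearEquiv.range, ← hσ.1]
    simp only [map_weightSpace e he]
  · rw [← map_weightSpace e he] at h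
    exact Submodule.map_injective_of_injective (f := e.toLinearMap) e.injective
      (h.trans (Submodule.map_bot _).symm)

theorem IsIrreducible.parityChange {ρ : 𝔤.Rep V} (h : ρ.IsIrreducible) :
    ρ.parityChange.IsIrreducible := by
  refine ⟨h.1, fun U hU => h.2 U ?_⟩
  intro u hu
  have h2 : (1 + 1 : ZMod 2) = 0 := by decide
  obtain ⟨a, ha, b, hb, hab⟩ := Submodule.mem_sup.1 (hU hu)
  refine Submodule.mem_sup.2 ⟨b, ⟨hb.1, ?_⟩, a, ⟨ha.1, ?_⟩, by rw [add_comm, hab]⟩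
  · have : b ∈ ρ.grading.part (1 + 1) := hb.2
    rwa [h2] at this
  · have : a ∈ ρ.grading.part (0 + 1) := ha.2
    rwa [zero_add] at this

theorem HasWeightsIn.parityChange {ρ : 𝔤.Rep V} {𝔥 : Submodule F L} {S : Set (Module.Dual F 𝔥)}
    (h : ρ.HasWeightsIn 𝔥 S) : ρ.parityChange.HasWeightsIn 𝔥 S := h

theorem trivialRep_isIrreducible : 𝔤.trivialRep.IsIrreducible :=
  ⟨inferInstanceAs (Nontrivial F), fun U _ _ => eq_bot_or_eq_top (α := Ideal F) U⟩

theorem trivialRep_hasWeightsIn {𝔥 : Submodule F L} {S : Set (Module.Dual F 𝔥)} (hS : 0 ∈ S) :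
    𝔤.trivialRep.HasWeightsIn 𝔥 S := by
  constructor
  · refine eq_top_iff.2 (le_iSup_of_le 0 fun v _ h => ?_)
    simp [trivialRep]
  · intro μ hμ
    obtain ⟨v, hv, hv0⟩ := (Submodule.ne_bot_iff _).1 hμ
    have : μ = 0 := by
      ext h
      have := hv h
      have h' : μ h • v = 0 := by simpa [trivialRep] using this.symm
      simpa [hv0] using h'
    rwa [this]

theorem IsIrreducible.exists_homogeneous {ρ : 𝔤.Rep V} (h : ρ.IsIrreducible) :
    ∃ i, ∃ v ∈ ρ.grading.part i, v ≠ 0 := by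
  obtain ⟨v, hv⟩ := @exists_ne V h.1 0
  obtain ⟨a, ha, b, hb, rfl⟩ := ρ.grading.exists_add v
  by_cases h0 : a = 0
  · exact ⟨1, b, hb, fun hb0 => hv (by rw [h0, hb0, add_zero])⟩
  · exact ⟨0, a, ha, h0⟩

/-- An irreducible module with zero action is trivial up to parity. -/
theorem isIso_trivialRep {ρ : 𝔤.Rep V} (h : ρ.IsIrreducible) (h0 : ∀ x v, ρ.act x v = 0) :
    ρ.IsIso 𝔤.trivialRep ∨ ρ.IsIso 𝔤.trivialRep.parityChange := by
  obtain ⟨i, v, hvi, hv⟩ := h.exists_homogeneous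
  have hiso : ∀ σ : 𝔤.Rep F, σ.IsIrreducible → (∀ x y, σ.act x y = 0) →
      (1 : F) ∈ σ.grading.part i → ρ.IsIso σ := fun σ hσ hσ0 hσi =>
    -- With zero action every homogeneous element preserves every line, so nothing has to be
    -- lowered.
    isIso_of_highest h hσ (S := {x | ∃ i, x ∈ 𝔤.grading.part i}) (T := ∅) (fun a ha => ha)
      (by simp) (by
        rw [Set.union_empty, Submodule.eq_top_iff']
        intro x
        obtain ⟨a, ha, b, hb, rfl⟩ := 𝔤.grading.exists_add x
        exact add_mem (Submodule.subset_span ⟨0, ha⟩) (Submodule.subset_span ⟨1, hb⟩))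
      hvi hσi (fun a _ => ⟨0, by simp [h0], by simp [hσ0]⟩) (V' := ⊥) (W' := ⊥) (by simpa using hv)
      (by simp) (by simp) (by simp) (by simp) (by simp)
  rcases zmod_two_cases i with rfl | rfl
  · exact Or.inl (hiso _ trivialRep_isIrreducible (fun _ _ => rfl) (by simp [trivialRep]))
  · refine Or.inr (hiso _ trivialRep_isIrreducible.parityChange (fun _ _ => rfl) ?_)
    have h2 : (1 + 1 : ZMod 2) = 0 := by decide
    simp [trivialRep, Rep.parityChange, SuperGrading.parityChange, h2]

/-- An even `𝔥` preserves parity, so both homogeneous components of a weight vector are weight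
vectors or zero. -/
theorem exists_homogeneous_weight {ρ : 𝔤.Rep V} {𝔥 : Submodule F L} (h𝔥 : 𝔥 ≤ 𝔤.grading.part 0)
    {μ : Module.Dual F 𝔥} (h : ρ.weightSpace 𝔥 μ ≠ ⊥) :
    ∃ i, ∃ v ∈ ρ.grading.part i, v ∈ ρ.weightSpace 𝔥 μ ∧ v ≠ 0 := by
  obtain ⟨v, hv, hv0⟩ := (Submodule.ne_bot_iff _).1 h
  obtain ⟨a, ha, b, hb, rfl⟩ := ρ.grading.exists_add v
  have key : ∀ x : 𝔥, ρ.act x.1 a = μ x • a ∧ ρ.act x.1 b = μ x • b := fun x => by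
    have h0 := ρ.act_mem (h𝔥 x.2) ha
    have h1 := ρ.act_mem (h𝔥 x.2) hb
    rw [zero_add] at h0 h1
    refine ρ.grading.add_eq_add h0 (Submodule.smul_mem _ _ ha) h1 (Submodule.smul_mem _ _ hb) ?_
    rw [← map_add, ← smul_add]
    exact hv x
  by_cases h0 : a = 0
  · exact ⟨1, b, hb, fun x => (key x).2, fun hb0 => hv0 (by rw [h0, hb0, add_zero])⟩
  · exact ⟨0, a, ha, fun x => (key x).1, h0⟩

end LieSuperalgebra.Rep

/-! ### Matrix units, coroots and roots of A(m,n) -/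

namespace TypeA

open LieSuperalgebra

section Brackets

variable (F : Type*) [Field F] {m n : ℕ}

/-- The sign `(-1)^{|a| + |b|}` of a pair of indices. -/
def sign (a b : Fin (m + 1) ⊕ Fin (n + 1)) : ℤ := if parity a = parity b then 1 else -1

theorem parity_mul_self (a : Fin (m + 1) ⊕ Fin (n + 1)) :
    (if parity a = 0 then (1 : F) else -1) * (if parity a = 0 then (1 : F) else -1) = 1 := by
  split_ifs <;> simp

theorem sign_eq_mul (a b : Fin (m + 1) ⊕ Fin (n + 1)) :
    (sign a b : F) = (if parity a = 0 then (1 : F) else -1) *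
      (if parity b = 0 then (1 : F) else -1) := by
  unfold sign
  rcases zmod_two_cases (parity a) with ha | ha <;>
    rcases zmod_two_cases (parity b) with hb | hb <;> simp [ha, hb]

theorem koszulSign_eq_sign (a b : Fin (m + 1) ⊕ Fin (n + 1)) :
    koszulSign F (parity a + parity b) (parity b + parity a) = sign a b := by
  unfold sign koszulSign
  rcases zmod_two_cases (parity a) with ha | ha <;>
    rcases zmod_two_cases (parity b) with hb | hb <;> simp [ha, hb]

theorem single_mem_matPart (a b : Fin (m + 1) ⊕ Fin (n + 1)) (c : F) :
    Matrix.single a b c ∈ matPart F m n (parity a + parity b) := by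
  intro i j h
  refine Matrix.single_apply_of_ne _ _ _ _ _ fun hij => h ?_
  rw [hij.1, hij.2]

/-- The form in which m + n ≥ 1 enters: there are at least three indices. -/
theorem exists_third (h1 : 1 ≤ m + n) (k l : Fin (m + 1) ⊕ Fin (n + 1)) : ∃ j, j ≠ k ∧ j ≠ l := by
  have hc : ({k, l} : Finset (Fin (m + 1) ⊕ Fin (n + 1))).card < Fintype.card
      (Fin (m + 1) ⊕ Fin (n + 1)) := by
    refine lt_of_le_of_lt Finset.card_le_two ?_
    simp only [Fintype.card_sum, Fintype.card_fin]
    omega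
  obtain ⟨j, hj⟩ : ∃ j, j ∉ ({k, l} : Finset (Fin (m + 1) ⊕ Fin (n + 1))) := by
    by_contra! h
    rw [Finset.eq_univ_iff_forall.2 h, Finset.card_univ] at hc
    exact lt_irrefl _ hc
  exact ⟨j, by simpa using hj⟩

/-- The matrix unit `E_{kl}` for `k ≠ l` (and `0` if `k = l`). -/
def rootMat (k l : Fin (m + 1) ⊕ Fin (n + 1)) : slSpace F m n :=
  ⟨if k = l then 0 else Matrix.single k l 1, by
    refine LinearMap.mem_ker.2 ?_
    rw [supertrace_eq_sum]
    refine Finset.sum_eq_zero fun i _ => ?_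
    have h : (if k = l then 0 else Matrix.single k l (1 : F)) i i = 0 := by
      split_ifs with h
      · rfl
      · exact Matrix.single_apply_of_ne _ _ _ _ _ fun h' => h (h'.1.trans h'.2.symm)
    rw [h, mul_zero]⟩

theorem rootMat_coe {k l : Fin (m + 1) ⊕ Fin (n + 1)} (h : k ≠ l) :
    (rootMat F k l).1 = Matrix.single k l 1 := if_neg h

/-- The diagonal matrix `E_{aa} - (-1)^{|a| + |b|} E_{bb}`. -/
def corootMat (a b : Fin (m + 1) ⊕ Fin (n + 1)) : slSpace F m n :=
  ⟨Matrix.single a a 1 - (sign a b : F) • Matrix.single b b 1, by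
    refine LinearMap.mem_ker.2 ?_
    have h : ∀ c : Fin (m + 1) ⊕ Fin (n + 1), supertrace F m n (Matrix.single c c 1) =
        if parity c = 0 then (1 : F) else -1 := fun c => by
      rw [supertrace_eq_sum, Finset.sum_eq_single c]
      · simp
      · intro i _ hi
        rw [Matrix.single_apply_of_ne _ _ _ _ _ fun h => hi h.1.symm, mul_zero]
      · simp
    rw [map_sub, map_smul, h, h, smul_eq_mul, sign_eq_mul, mul_assoc, parity_mul_self, mul_one,
      sub_self]⟩

theorem corootMat_isDiag (a b : Fin (m + 1) ⊕ Fin (n + 1)) : (corootMat F a b).1.IsDiag := by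
  intro i j hij
  have h : ∀ (c : Fin (m + 1) ⊕ Fin (n + 1)) (x : F), Matrix.single c c x i j = 0 := fun c x =>
    Matrix.single_apply_of_ne _ _ _ _ _ fun h => hij (h.1.symm.trans h.2)
  simp [corootMat, h]

theorem isDiag_mem_even {D : Mat F m n} (hD : D.IsDiag) : D ∈ matPart F m n 0 := by
  intro i j h
  refine hD ?_
  rintro rfl
  exact h ((zmod2_add_eq _ _).2 rfl)

theorem superBracket_diag {D : Mat F m n} (hD : D.IsDiag) (X : Mat F m n)
    (i j : Fin (m + 1) ⊕ Fin (n + 1)) :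
    superBracket F m n D X i j = (D i i - D j j) * X i j := by
  have h : superBracket F m n D X = D * X - X * D := by
    simp [superBracket, oddPart_of_even F m n (isDiag_mem_even F hD)]
  rw [h, ← hD.diagonal_diag, Matrix.sub_apply, Matrix.diagonal_mul, Matrix.mul_diagonal]
  simp
  ring

/-- The root vector of the root `ε_k - ε_l`. -/
def rootVec (k l : Fin (m + 1) ⊕ Fin (n + 1)) : slSpace F m n ⧸ scalars F m n :=
  (scalars F m n).mkQ (rootMat F k l)

/-- The coroot of the root `ε_a - ε_b`, as an element of the Cartan subalgebra. -/
def coroot (a b : Fin (m + 1) ⊕ Fin (n + 1)) : cartan F m n :=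
  ⟨(scalars F m n).mkQ (corootMat F a b), ⟨corootMat F a b, corootMat_isDiag F a b, rfl⟩⟩

theorem bracket_mkQ (X Y : slSpace F m n) :
    (A F m n).bracket ((scalars F m n).mkQ X) ((scalars F m n).mkQ Y) =
      (scalars F m n).mkQ ((sl F m n).bracket X Y) := rfl

theorem sl_bracket_coe (X Y : slSpace F m n) :
    ((sl F m n).bracket X Y).1 = superBracket F m n X.1 Y.1 := rfl

theorem mkQ_eq_zero {X : slSpace F m n} :
    (scalars F m n).mkQ X = 0 ↔ ∃ c : F, c • (1 : Mat F m n) = X.1 := by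
  rw [← LinearMap.mem_ker, Submodule.ker_mkQ]
  exact Submodule.mem_span_singleton

theorem mkQ_mem_part {X : slSpace F m n} {i : ZMod 2} (h : X.1 ∈ matPart F m n i) :
    (scalars F m n).mkQ X ∈ (A F m n).grading.part i := ⟨X, h, rfl⟩

theorem rootVec_mem_part (k l : Fin (m + 1) ⊕ Fin (n + 1)) :
    rootVec F k l ∈ (A F m n).grading.part (parity k + parity l) := by
  refine mkQ_mem_part F ?_
  rcases eq_or_ne k l with rfl | h
  · simp [rootMat]
  · rw [rootMat_coe F h]
    exact single_mem_matPart F k l 1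

theorem cartan_le_even : cartan F m n ≤ (A F m n).grading.part 0 := by
  rintro _ ⟨D, hD, rfl⟩
  exact mkQ_mem_part F (isDiag_mem_even F hD)

theorem rootVec_ne_zero {k l : Fin (m + 1) ⊕ Fin (n + 1)} (h : k ≠ l) : rootVec F k l ≠ 0 := by
  intro h0
  obtain ⟨c, hc⟩ := (mkQ_eq_zero F).1 h0
  have := congrFun (congrFun hc k) l
  simp [rootMat_coe F h, Matrix.one_apply_ne h] at this

theorem bracket_rootVec_swap {a b : Fin (m + 1) ⊕ Fin (n + 1)} (h : a ≠ b) :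
    (A F m n).bracket (rootVec F a b) (rootVec F b a) = coroot F a b := by
  refine congrArg (scalars F m n).mkQ (Subtype.ext ?_)
  rw [sl_bracket_coe, rootMat_coe F h, rootMat_coe F h.symm,
    superBracket_of_mem F m n (single_mem_matPart F a b 1) (single_mem_matPart F b a 1),
    koszulSign_eq_sign]
  simp [corootMat]

theorem bracket_rootVec {a b c : Fin (m + 1) ⊕ Fin (n + 1)} (hab : a ≠ b) (hbc : b ≠ c)
    (hac : a ≠ c) : (A F m n).bracket (rootVec F a b) (rootVec F b c) = rootVec F a c := by
  refine congrArg (scalars F m n).mkQ (Subtype.ext ?_)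
  rw [sl_bracket_coe, rootMat_coe F hab, rootMat_coe F hbc, rootMat_coe F hac,
    superBracket_of_mem F m n (single_mem_matPart F a b 1) (single_mem_matPart F b c 1),
    Matrix.single_mul_single_of_ne (h := hac.symm)]
  simp

/-- The root `ε_k - ε_l`. -/
def root (k l : Fin (m + 1) ⊕ Fin (n + 1)) : Module.Dual F (cartan F m n) :=
  ((scalars F m n).liftQ
    ((Matrix.entryLinearMap F F k k - Matrix.entryLinearMap F F l l) ∘ₗ (slSpace F m n).subtype)
    (by
      intro X hX
      obtain ⟨c, hc⟩ := Submodule.mem_span_singleton.1 hX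
      have : X.1 = c • (1 : Mat F m n) := hc.symm
      simp [this])) ∘ₗ (cartan F m n).subtype

theorem root_apply (k l : Fin (m + 1) ⊕ Fin (n + 1)) (D : slSpace F m n)
    (hD : (scalars F m n).mkQ D ∈ cartan F m n) :
    root F k l ⟨(scalars F m n).mkQ D, hD⟩ = D.1 k k - D.1 l l := rfl

theorem root_add (i j k : Fin (m + 1) ⊕ Fin (n + 1)) : root F i j + root F j k = root F i k := by
  ext ⟨_, D, hD, rfl⟩
  exact sub_add_sub_cancel _ _ _

/-- The Cartan integers `(ε_k - ε_l)(h_{ab})`. -/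
def cartanInt (k l a b : Fin (m + 1) ⊕ Fin (n + 1)) : ℤ :=
  ((if k = a then 1 else 0) - sign a b * (if k = b then 1 else 0)) -
    ((if l = a then 1 else 0) - sign a b * (if l = b then 1 else 0))

theorem root_coroot (k l a b : Fin (m + 1) ⊕ Fin (n + 1)) :
    root F k l (coroot F a b) = cartanInt k l a b := by
  have h : ∀ k : Fin (m + 1) ⊕ Fin (n + 1), (corootMat F a b).1 k k =
      (((if k = a then 1 else 0) - sign a b * (if k = b then 1 else 0) : ℤ) : F) := fun k => by
    simp [corootMat, Matrix.single_apply, eq_comm]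
  refine (root_apply F k l (corootMat F a b) (coroot F a b).2).trans ?_
  rw [h, h, cartanInt]
  push_cast
  ring

theorem bracket_diag_rootVec {D : slSpace F m n} (hD : D.1.IsDiag)
    (k l : Fin (m + 1) ⊕ Fin (n + 1)) :
    (A F m n).bracket ((scalars F m n).mkQ D) (rootVec F k l) =
      (D.1 k k - D.1 l l) • rootVec F k l := by
  rw [rootVec, bracket_mkQ, ← map_smul]
  refine congrArg (scalars F m n).mkQ (Subtype.ext ?_)
  ext i j
  rw [sl_bracket_coe, superBracket_diag F hD]
  change _ = (D.1 k k - D.1 l l) * (rootMat F k l).1 i j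
  rcases eq_or_ne k l with rfl | h
  · simp [rootMat]
  · by_cases hij : k = i ∧ l = j
    · rw [hij.1, hij.2]
    · rw [rootMat_coe F h, Matrix.single_apply_of_ne _ _ _ _ _ hij, mul_zero, mul_zero]

theorem bracket_cartan {x y : slSpace F m n ⧸ scalars F m n} (hx : x ∈ cartan F m n)
    (hy : y ∈ cartan F m n) : (A F m n).bracket x y = 0 := by
  obtain ⟨D, hD, rfl⟩ := hx
  obtain ⟨D', hD', rfl⟩ := hy
  rw [bracket_mkQ, ← map_zero (scalars F m n).mkQ]
  refine congrArg (scalars F m n).mkQ (Subtype.ext ?_)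
  ext i j
  rw [sl_bracket_coe, superBracket_diag F hD]
  rcases eq_or_ne i j with rfl | h
  · simp
  · rw [hD' h]
    simp

theorem rootVec_mem_weightSpace (k l : Fin (m + 1) ⊕ Fin (n + 1)) :
    rootVec F k l ∈ (A F m n).adjointRep.weightSpace (cartan F m n) (root F k l) := by
  rintro ⟨_, D, hD, rfl⟩
  exact bracket_diag_rootVec F hD k l

theorem mem_span_rootVec (x : slSpace F m n ⧸ scalars F m n) :
    ∃ D : slSpace F m n, D.1.IsDiag ∧ ∃ c : (Fin (m + 1) ⊕ Fin (n + 1)) →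
      (Fin (m + 1) ⊕ Fin (n + 1)) → F,
      x = (scalars F m n).mkQ D + ∑ k, ∑ l, c k l • rootVec F k l := by
  obtain ⟨X, rfl⟩ := (scalars F m n).mkQ_surjective x
  refine ⟨X - ∑ k, ∑ l, X.1 k l • rootMat F k l, ?_, X.1, ?_⟩
  · intro i j hij
    have : (∑ k, ∑ l, X.1 k l • rootMat F k l).1 i j = X.1 i j := by
      simp only [Submodule.coe_sum, Submodule.coe_smul, Matrix.sum_apply, Matrix.smul_apply]
      rw [Finset.sum_eq_single i, Finset.sum_eq_single j]
      · simp [rootMat_coe F hij]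
      · intro l _ hl
        rcases eq_or_ne i l with rfl | h
        · simp [rootMat]
        · rw [rootMat_coe F h, Matrix.single_apply_of_ne _ _ _ _ _ fun h => hl h.2, smul_zero]
      · simp
      · intro k _ hk
        refine Finset.sum_eq_zero fun l _ => ?_
        rcases eq_or_ne k l with rfl | h
        · simp [rootMat]
        · rw [rootMat_coe F h, Matrix.single_apply_of_ne _ _ _ _ _ fun h => hk h.1, smul_zero]
      · simp
    change X.1 i j - _ = 0
    rw [this, sub_self]
  · simp only [rootVec, map_sub, map_sum, map_smul, sub_add_cancel]

theorem span_rootVec : Submodule.span F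
    ({x | ∃ k l, k ≠ l ∧ rootVec F k l = x} ∪ {x | x ∈ cartan F m n}) = ⊤ := by
  refine Submodule.eq_top_iff'.2 fun x => ?_
  obtain ⟨D, hD, c, rfl⟩ := mem_span_rootVec F x
  refine add_mem (Submodule.subset_span (Or.inr ⟨D, hD, rfl⟩)) (Submodule.sum_mem _ fun k _ =>
    Submodule.sum_mem _ fun l _ => Submodule.smul_mem _ _ ?_)
  rcases eq_or_ne k l with rfl | h
  · simp [rootVec, rootMat, show (⟨0, zero_mem _⟩ : slSpace F m n) = 0 from rfl]
  · exact Submodule.subset_span (Or.inl ⟨k, l, h, rfl⟩)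

theorem adjointRep_hasWeightsIn : (A F m n).adjointRep.HasWeightsIn (cartan F m n)
    ((A F m n).roots (cartan F m n) ∪ {0}) := by
  constructor
  · rw [eq_top_iff, ← span_rootVec F, Submodule.span_le]
    rintro _ (⟨k, l, -, rfl⟩ | hx)
    · exact le_iSup (fun μ => (A F m n).adjointRep.weightSpace (cartan F m n) μ) (root F k l)
        (rootVec_mem_weightSpace F k l)
    · refine le_iSup (fun μ => (A F m n).adjointRep.weightSpace (cartan F m n) μ) 0 fun h => ?_
      rw [LinearMap.zero_apply, zero_smul]
      exact bracket_cartan F h.2 hx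
  · intro μ hμ
    rcases eq_or_ne μ 0 with rfl | h
    · exact Or.inr rfl
    · exact Or.inl ⟨h, hμ⟩

/-- A diagonal representative would force μ = 0. Otherwise μ is read off at a nonzero off-diagonal
entry, where the ambiguity modulo scalar matrices is invisible. -/
theorem exists_eq_root {μ : Module.Dual F (cartan F m n)}
    (hμ : μ ∈ (A F m n).roots (cartan F m n)) : ∃ k l, k ≠ l ∧ μ = root F k l := by
  obtain ⟨hμ0, hμ⟩ := hμ
  obtain ⟨x, hx, hx0⟩ := (Submodule.ne_bot_iff _).1 hμ
  obtain ⟨X, rfl⟩ := (scalars F m n).mkQ_surjective x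
  by_cases hX : X.1.IsDiag
  · refine absurd (LinearMap.ext fun h => ?_) hμ0
    have h1 := hx h
    have h2 : (A F m n).bracket h.1 ((scalars F m n).mkQ X) = 0 :=
      bracket_cartan F h.2 ⟨X, hX, rfl⟩
    have h3 : μ h • (scalars F m n).mkQ X = 0 := h1.symm.trans h2
    exact (smul_eq_zero.1 h3).resolve_right hx0
  · simp only [Matrix.IsDiag, Pairwise, not_forall] at hX
    obtain ⟨k, l, hkl, hX⟩ := hX
    refine ⟨k, l, hkl, LinearMap.ext ?_⟩
    rintro ⟨_, D, hD, rfl⟩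
    have h1 : (scalars F m n).mkQ ((sl F m n).bracket D X) =
      μ ⟨_, D, hD, rfl⟩ • (scalars F m n).mkQ X := hx ⟨_, D, hD, rfl⟩
    rw [← map_smul, ← sub_eq_zero, ← map_sub, mkQ_eq_zero] at h1
    obtain ⟨c, hc⟩ := h1
    have h2 := congrFun (congrFun hc k) l
    have h3 : (c • (1 : Mat F m n)) k l = 0 := by simp [Matrix.one_apply_ne hkl]
    rw [h3] at h2
    have h4 : superBracket F m n D.1 X.1 k l - μ ⟨_, D, hD, rfl⟩ * X.1 k l = 0 := h2.symm
    rw [superBracket_diag F hD, ← sub_mul] at h4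
    exact (sub_eq_zero.1 ((mul_eq_zero.1 h4).resolve_right hX)).symm

end Brackets

end TypeA

/-! ### Simplicity of A(m,n) -/

namespace TypeA

open LieSuperalgebra

section Simplicity

variable {F : Type*} [Field F] {m n : ℕ}

/-- An ideal containing one root vector contains all of them. -/
theorem rootVec_mem_ideal (h1 : 1 ≤ m + n) {U : Submodule F (slSpace F m n ⧸ scalars F m n)}
    (hl : ∀ x, ∀ y ∈ U, (A F m n).bracket x y ∈ U) (hr : ∀ x ∈ U, ∀ y, (A F m n).bracket x y ∈ U)
    {k l : Fin (m + 1) ⊕ Fin (n + 1)} (hkl : k ≠ l) (hU : rootVec F k l ∈ U)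
    {a b : Fin (m + 1) ⊕ Fin (n + 1)} (hab : a ≠ b) : rootVec F a b ∈ U := by
  -- Bracketing with a matrix unit replaces one index at a time, as long as the two indices stay
  -- distinct.
  have right : ∀ {a b c : Fin (m + 1) ⊕ Fin (n + 1)}, a ≠ b → rootVec F a b ∈ U → c ≠ a →
      rootVec F a c ∈ U := by
    intro a b c hab h hca
    rcases eq_or_ne c b with rfl | hcb
    · exact h
    · rw [← bracket_rootVec F hab hcb.symm hca.symm]
      exact hr _ h _
  have left : ∀ {a b c : Fin (m + 1) ⊕ Fin (n + 1)}, a ≠ b → rootVec F a b ∈ U → c ≠ b →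
      rootVec F c b ∈ U := by
    intro a b c hab h hcb
    rcases eq_or_ne c a with rfl | hca
    · exact h
    · rw [← bracket_rootVec F hca hab hcb]
      exact hl _ _ h
  have key : ∀ {a b : Fin (m + 1) ⊕ Fin (n + 1)}, a ≠ b → a ≠ l → rootVec F a b ∈ U :=
    fun hab hal => right hal (left hkl hU hal) hab.symm
  rcases eq_or_ne a l with rfl | hal
  -- E_kl cannot become E_ll on the way to E_lb, so the path goes through E_cb with a third index c.
  · obtain ⟨c, hca, hcb⟩ := exists_third h1 a b
    exact left hcb (key hcb hca) hab
  · exact key hab hal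

/-- An ideal containing a root vector is everything. -/
theorem ideal_eq_top (h1 : 1 ≤ m + n) {U : Submodule F (slSpace F m n ⧸ scalars F m n)}
    (hl : ∀ x, ∀ y ∈ U, (A F m n).bracket x y ∈ U) (hr : ∀ x ∈ U, ∀ y, (A F m n).bracket x y ∈ U)
    {k l : Fin (m + 1) ⊕ Fin (n + 1)} (hkl : k ≠ l) (hU : rootVec F k l ∈ U) : U = ⊤ := by
  have hco : ∀ {a b : Fin (m + 1) ⊕ Fin (n + 1)}, a ≠ b → (coroot F a b).1 ∈ U := fun hab => by
    rw [← bracket_rootVec_swap F hab]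
    exact hl _ _ (rootVec_mem_ideal h1 hl hr hkl hU hab.symm)
  rw [eq_top_iff, ← span_rootVec F, Submodule.span_le]
  rintro _ (⟨a, b, hab, rfl⟩ | ⟨D, hD, rfl⟩)
  · exact rootVec_mem_ideal h1 hl hr hkl hU hab
  · have hsum : D = ∑ a, D.1 a a • corootMat F a (Sum.inl 0) := by
      refine Subtype.ext ?_
      ext i j
      rcases eq_or_ne i j with rfl | hij
      · simp only [Submodule.coe_sum, Submodule.coe_smul, Matrix.sum_apply, Matrix.smul_apply,
          corootMat, Matrix.sub_apply, smul_eq_mul, mul_sub, Finset.sum_sub_distrib]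
        have hA : ∑ x, D.1 x x * Matrix.single x x (1 : F) i i = D.1 i i := by
          rw [Finset.sum_eq_single i]
          · simp
          · intro x _ hx
            rw [Matrix.single_apply_of_ne _ _ _ _ _ fun h => hx h.1, mul_zero]
          · simp
        have hB : ∑ x, D.1 x x * ((sign x (Sum.inl 0 : Fin (m + 1) ⊕ Fin (n + 1)) : F) *
            Matrix.single (Sum.inl 0 : Fin (m + 1) ⊕ Fin (n + 1)) (Sum.inl 0) (1 : F) i i) = 0 := by
          have h0 : supertrace F m n D.1 = 0 := D.2
          rw [supertrace_eq_sum] at h0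
          simp only [← mul_assoc]
          rw [← Finset.sum_mul]
          refine mul_eq_zero_of_left (Eq.trans (Finset.sum_congr rfl fun x _ => ?_) h0) _
          rw [sign_eq_mul, mul_comm]
          simp [parity]
        rw [hA, hB, sub_zero]
      · rw [hD hij]
        simp [Matrix.sum_apply, corootMat_isDiag F _ _ hij]
    rw [hsum, map_sum]
    refine U.sum_mem fun a _ => ?_
    rw [map_smul]
    refine U.smul_mem _ ?_
    rcases eq_or_ne a (Sum.inl 0) with rfl | ha
    · have : corootMat F (Sum.inl 0 : Fin (m + 1) ⊕ Fin (n + 1)) (Sum.inl 0) = 0 :=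
        Subtype.ext (by simp [corootMat, sign])
      rw [this, map_zero]
      exact U.zero_mem
    · exact hco ha

/-- For E = E_lk even with E² = 0, only the middle term -2EXE of the double commutator survives. It
isolates one entry of X in an ideal. -/
theorem bracket_bracket_single {X : Mat F m n} {k l : Fin (m + 1) ⊕ Fin (n + 1)} (hkl : k ≠ l)
    (hp : parity l + parity k = 0) :
    superBracket F m n (Matrix.single l k 1) (superBracket F m n (Matrix.single l k 1) X) =
      (-2 * X k l) • Matrix.single l k 1 := by
  have hE := single_mem_matPart (m := m) (n := n) F l k 1
  rw [hp] at hE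
  have h : ∀ Y, superBracket F m n (Matrix.single l k 1) Y =
      Matrix.single l k 1 * Y - Y * Matrix.single l k 1 := fun Y => by
    simp [superBracket, oddPart_of_even F m n hE]
  have h0 : Matrix.single l k (1 : F) * Matrix.single l k 1 = 0 :=
    Matrix.single_mul_single_of_ne (h := hkl) ..
  rw [h, h, mul_sub, sub_mul, ← mul_assoc, h0, mul_assoc X, h0, ← mul_assoc,
    Matrix.single_mul_mul_single]
  ext i j
  simp [Matrix.single_apply]
  split_ifs <;> ring

/-- Every product with E_jk on the right has zero l-th column, so only E_jk X contributes. This and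
its mirror image move an entry from an odd position to an even one. -/
theorem bracket_single_left {X : Mat F m n} {j k l : Fin (m + 1) ⊕ Fin (n + 1)} (hkl : k ≠ l) :
    superBracket F m n (Matrix.single j k 1) X j l = X k l := by
  have hE := single_mem_matPart (m := m) (n := n) F j k 1
  have h2 : (oddPart F m n X * oddPart F m n (Matrix.single j k 1)) j l = 0 := by
    rcases zmod_two_cases (parity j + parity k) with h | h <;> rw [h] at hE
    · simp [oddPart_of_even F m n hE]
    · rw [oddPart_of_odd F m n hE, Matrix.mul_single_apply_of_ne _ _ _ _ _ hkl.symm]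
  simp [superBracket, h2, Matrix.mul_single_apply_of_ne _ _ _ _ _ hkl.symm]

theorem bracket_single_right {X : Mat F m n} {j k l : Fin (m + 1) ⊕ Fin (n + 1)} (hkl : k ≠ l) :
    superBracket F m n X (Matrix.single l j 1) k j = X k l := by
  have hE := single_mem_matPart (m := m) (n := n) F l j 1
  have h2 : (oddPart F m n (Matrix.single l j 1) * oddPart F m n X) k j = 0 := by
    rcases zmod_two_cases (parity l + parity j) with h | h <;> rw [h] at hE
    · simp [oddPart_of_even F m n hE]
    · rw [oddPart_of_odd F m n hE, Matrix.single_mul_apply_of_ne _ _ _ _ _ hkl]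
  simp [superBracket, h2, Matrix.single_mul_apply_of_ne _ _ _ _ _ hkl]

/-- The Lie superalgebra `A(m, n)` is simple. -/
theorem adjointRep_isIrreducible [CharZero F] (h1 : 1 ≤ m + n) :
    (A F m n).adjointRep.IsIrreducible := by
  refine ⟨?_, fun U hUg hl => or_iff_not_imp_left.2 fun hU => ?_⟩
  · obtain ⟨j, hj, -⟩ := exists_third h1 (Sum.inl 0) (Sum.inl 0)
    exact ⟨⟨rootVec F j (Sum.inl 0), 0, rootVec_ne_zero F hj⟩⟩
  replace hl : ∀ x, ∀ y ∈ U, (A F m n).bracket x y ∈ U := hl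
  -- Skew-symmetry holds only for homogeneous elements, so the gradedness of `U` is what makes it a
  -- two-sided ideal.
  have hr : ∀ x ∈ U, ∀ y, (A F m n).bracket x y ∈ U := by
    intro x hx y
    obtain ⟨x₀, hx₀, x₁, hx₁, rfl⟩ := Submodule.mem_sup.1 (hUg hx)
    obtain ⟨y₀, hy₀, y₁, hy₁, rfl⟩ := (A F m n).grading.exists_add y
    have key : ∀ {i j : ZMod 2} {a b : slSpace F m n ⧸ scalars F m n},
        a ∈ U ⊓ (A F m n).grading.part i → b ∈ (A F m n).grading.part j →
        (A F m n).bracket a b ∈ U := fun ha hb => by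
      rw [(A F m n).skew ha.2 hb]
      exact U.neg_mem (U.smul_mem _ (hl _ _ ha.1))
    simp only [map_add, LinearMap.add_apply]
    exact add_mem (add_mem (key hx₀ hy₀) (key hx₁ hy₀)) (add_mem (key hx₀ hy₁) (key hx₁ hy₁))
  have same : ∀ (X : slSpace F m n) {k l : Fin (m + 1) ⊕ Fin (n + 1)}, k ≠ l →
      parity l + parity k = 0 → (scalars F m n).mkQ X ∈ U → X.1 k l ≠ 0 → U = ⊤ := by
    intro X k l hkl hp hX hX0
    refine ideal_eq_top h1 hl hr hkl.symm ((U.smul_mem_iff (s := -2 * X.1 k l)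
      (mul_ne_zero (by simp) hX0)).1 ?_)
    have h := hl (rootVec F l k) _ (hl (rootVec F l k) _ hX)
    rw [rootVec, bracket_mkQ, bracket_mkQ] at h
    convert h using 1
    rw [rootVec, ← map_smul]
    refine congrArg (scalars F m n).mkQ (Subtype.ext ?_)
    rw [sl_bracket_coe, sl_bracket_coe, rootMat_coe F hkl.symm, bracket_bracket_single hkl hp,
      ← rootMat_coe F hkl.symm]
    rfl
  obtain ⟨x, hx, hx0⟩ := (Submodule.ne_bot_iff _).1 hU
  obtain ⟨X, rfl⟩ := (scalars F m n).mkQ_surjective x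
  by_cases hX : X.1.IsDiag
  -- X is not scalar, so two diagonal entries differ, and their difference is the eigenvalue of X on
  -- the corresponding root vector.
  · obtain ⟨k, hk⟩ : ∃ k, X.1 k k ≠ X.1 (Sum.inl 0) (Sum.inl 0) := by
      by_contra! h
      refine hx0 ((mkQ_eq_zero F).2 ⟨X.1 (Sum.inl 0) (Sum.inl 0), ?_⟩)
      ext i j
      rcases eq_or_ne i j with rfl | hij
      · simp [h]
      · simp [hX hij, Matrix.one_apply_ne hij]
    have hk0 : k ≠ Sum.inl 0 := by
      rintro rfl
      exact hk rfl
    refine ideal_eq_top h1 hl hr hk0 ((U.smul_mem_iff (sub_ne_zero.2 hk)).1 ?_)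
    rw [← bracket_diag_rootVec F hX]
    exact hr _ hx _
  · simp only [Matrix.IsDiag, Pairwise, not_forall] at hX
    obtain ⟨k, l, hkl, hX⟩ := hX
    rcases zmod_two_cases (parity l + parity k) with hp | hp
    · exact same X hkl hp hx hX
    -- The nonzero entry sits in an odd block. A third index shares the parity of k or of l, and one
    -- bracket carries the entry to the even position (k, j) or (j, l).
    · obtain ⟨j, hjk, hjl⟩ := exists_third h1 k l
      rcases zmod_two_cases (parity j + parity k) with hj | hj
      · refine same _ hjk.symm hj (hr _ hx (rootVec F l j)) ?_
        rw [sl_bracket_coe, rootMat_coe F hjl.symm, bracket_single_right hkl]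
        exact hX
      · have hj' : parity l + parity j = 0 := by
          revert hp hj
          generalize parity l = a
          generalize parity j = b
          generalize parity k = c
          revert a b c
          decide
        refine same _ hjl hj' (hl (rootVec F j k) _ hx) ?_
        rw [sl_bracket_coe, rootMat_coe F hjk, bracket_single_left hkl]
        exact hX

end Simplicity

end TypeA

/-! ### Root strings, and modules without even roots as weights -/

namespace TypeA

open LieSuperalgebra

section Weights

variable {F : Type*} [Field F] {m n : ℕ} {V : Type*} [AddCommGroup V] [Module F V]

theorem act_rootVec_mem (ρ : (A F m n).Rep V) {μ : Module.Dual F (cartan F m n)} {v : V}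
    (hv : v ∈ ρ.weightSpace (cartan F m n) μ) (k l : Fin (m + 1) ⊕ Fin (n + 1)) :
    ρ.act (rootVec F k l) v ∈ ρ.weightSpace (cartan F m n) (μ + root F k l) := by
  intro h
  have h2 : (A F m n).bracket h.1 (rootVec F k l) = root F k l h • rootVec F k l :=
    rootVec_mem_weightSpace F k l h
  rw [ρ.act_act (cartan_le_even F h.2) (rootVec_mem_part F k l), h2, hv h]
  have hs : koszulSign F 0 (parity k + parity l) = 1 := if_neg fun h => zero_ne_one h.1
  rw [hs, one_smul, map_smul, map_smul, LinearMap.smul_apply, LinearMap.add_apply, add_smul,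
    add_comm]

/-- The rank-one computation efv = [e,f]v when ev = 0, the same for even and odd roots. -/
theorem act_rootVec_swap (ρ : (A F m n).Rep V) {μ : Module.Dual F (cartan F m n)} {v : V}
    (hv : v ∈ ρ.weightSpace (cartan F m n) μ) {a b : Fin (m + 1) ⊕ Fin (n + 1)} (hab : a ≠ b)
    (h0 : ρ.act (rootVec F a b) v = 0) :
    ρ.act (rootVec F a b) (ρ.act (rootVec F b a) v) = μ (coroot F a b) • v := by
  rw [ρ.act_act (rootVec_mem_part F a b) (rootVec_mem_part F b a), bracket_rootVec_swap F hab, h0,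
    map_zero, smul_zero, add_zero]
  exact hv _

/-- If `μ` is a weight, `μ + α` is not and `μ` does not vanish on the coroot of `α`, then `μ - α`
is a weight. -/
theorem weightSpace_sub_ne_bot (ρ : (A F m n).Rep V) {μ : Module.Dual F (cartan F m n)}
    (hμ : ρ.weightSpace (cartan F m n) μ ≠ ⊥) {a b : Fin (m + 1) ⊕ Fin (n + 1)} (hab : a ≠ b)
    (h0 : ρ.weightSpace (cartan F m n) (μ + root F a b) = ⊥) (hc : μ (coroot F a b) ≠ 0) :
    ρ.weightSpace (cartan F m n) (μ + root F b a) ≠ ⊥ := by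
  obtain ⟨v, hv, hv0⟩ := (Submodule.ne_bot_iff _).1 hμ
  refine (Submodule.ne_bot_iff _).2 ⟨_, act_rootVec_mem ρ hv b a, fun h => ?_⟩
  have h1 : ρ.act (rootVec F a b) v = 0 :=
    (Submodule.eq_bot_iff _).1 h0 _ (act_rootVec_mem ρ hv a b)
  have h2 := act_rootVec_swap ρ hv hab h1
  rw [h, map_zero] at h2
  exact (smul_ne_zero hc hv0) h2.symm

theorem neg_root (k l : Fin (m + 1) ⊕ Fin (n + 1)) : -root F k l = root F l k := by
  ext ⟨_, D, hD, rfl⟩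
  exact neg_sub _ _

variable [CharZero F]

theorem root_ne_zero (h1 : 1 ≤ m + n) {k l : Fin (m + 1) ⊕ Fin (n + 1)} (hkl : k ≠ l) :
    root F k l ≠ 0 := by
  intro h
  have key : ∀ a b, cartanInt k l a b = 0 := fun a b => by
    have := congrArg (fun μ => μ (coroot F a b)) h
    simpa [root_coroot] using this
  -- The coroot of the root itself is no use here: an odd root vanishes on it. The coroot of (k, j)
  -- gives 1.
  obtain ⟨j, hjk, hjl⟩ := exists_third h1 k l
  have h2 := key k j
  simp [cartanInt, hkl.symm, hjk.symm, hjl.symm] at h2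

theorem root_add_ne_zero_of_snd {i j r : Fin (m + 1) ⊕ Fin (n + 1)} (hij : i ≠ j)
    (hr : parity i ≠ parity r) (hp : parity i = parity j) : root F i r + root F j r ≠ 0 := by
  intro h
  have h2 := congrArg (fun μ => μ (coroot F i r)) h
  have hir : i ≠ r := fun h => hr (congrArg _ h)
  have hjr : j ≠ r := fun h => hr (hp.trans (congrArg _ h))
  simp [root_coroot, cartanInt, sign, hr, hir, hir.symm, hij.symm, hjr] at h2

/-- The restriction to odd roots is needed: in A(1,1) the left side is an even root, because there
the sums of the diagonal entries over the two blocks agree. -/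
theorem root_add_ne_of_snd {i j r k l : Fin (m + 1) ⊕ Fin (n + 1)} (hij : i ≠ j)
    (hr : parity i ≠ parity r) (hp : parity i = parity j) (hkl : parity k ≠ parity l) :
    root F i r + root F j r ≠ root F k l := by
  intro h
  have key : ∀ a b, cartanInt i r a b + cartanInt j r a b = cartanInt k l a b := fun a b => by
    have := congrArg (fun μ => μ (coroot F a b)) h
    simp only [LinearMap.add_apply, root_coroot] at this
    exact_mod_cast this
  have hir : i ≠ r := fun h => hr (congrArg _ h)
  have hjr : j ≠ r := fun h => hr (hp.trans (congrArg _ h))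
  have hk : k ≠ l := fun h => hkl (congrArg _ h)
  -- The left side takes the values 0 and -1 on h_ij and h_ir. For an odd root ε_k - ε_l these force
  -- k, l ∉ {i, j} and l = r. Then k has the parity of i, and on h_ik the two sides are 1 and -1.
  have h2 := key i j
  have h3 := key i r
  have h4 := key i k
  have h01 : ∀ a b c : ZMod 2, a ≠ b → b ≠ c → a = c := by decide
  have hrk : parity r = parity k ∨ parity i = parity k := by
    by_cases h : parity r = parity k
    · exact Or.inl h
    · exact Or.inr (h01 _ _ _ hr h)
  simp only [cartanInt, sign] at h2 h3 h4
  clear key h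
  grind

/-- If all weights are odd roots or zero, then the odd roots are not weights. -/
theorem odd_root_weightSpace_eq_bot (h1 : 1 ≤ m + n) (ρ : (A F m n).Rep V)
    (hρ : ∀ μ, ρ.weightSpace (cartan F m n) μ ≠ ⊥ →
      μ = 0 ∨ ∃ k l, parity k ≠ parity l ∧ μ = root F k l)
    (heven : ∀ k l, k ≠ l → parity k = parity l →
      ρ.weightSpace (cartan F m n) (root F k l) = ⊥)
    {i r : Fin (m + 1) ⊕ Fin (n + 1)} (hr : parity i ≠ parity r) :
    ρ.weightSpace (cartan F m n) (root F i r) = ⊥ := by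
  by_contra hV
  have hir : i ≠ r := fun h => hr (congrArg _ h)
  obtain ⟨j, hji, hjr⟩ := exists_third h1 i r
  by_cases hp : parity i = parity j
  -- Adding ε_r - ε_j gives the even root ε_i - ε_j, not a weight; subtracting it gives ε_i + ε_j -
  -- 2ε_r, which would then have to be one.
  · refine (hρ _ (weightSpace_sub_ne_bot ρ hV (a := r) (b := j) hjr.symm ?_ ?_)).elim
      (root_add_ne_zero_of_snd hji.symm hr hp)
      fun ⟨k, l, hkl, h⟩ => root_add_ne_of_snd hji.symm hr hp hkl h
    · rw [root_add]
      exact heven i j hji.symm hp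
    · have : parity r ≠ parity j := fun h => hr (hp.trans h.symm)
      simp [root_coroot, cartanInt, sign, this, hir, hji.symm, hjr.symm]
  · have hp' : parity r = parity j := by
      revert hr hp
      generalize parity i = a
      generalize parity j = b
      generalize parity r = c
      revert a b c
      decide
    -- The mirror case produces 2ε_i - ε_r - ε_j, which is excluded by the same two lemmas after a
    -- change of sign.
    refine (hρ _ (weightSpace_sub_ne_bot ρ hV (a := j) (b := i) hji ?_ ?_)).elim
      (fun h => root_add_ne_zero_of_snd (F := F) hjr.symm hr.symm hp' ?_)
      fun ⟨k, l, hkl, h⟩ => root_add_ne_of_snd (F := F) hjr.symm hr.symm hp' hkl.symm ?_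
    · rw [add_comm (root F i r), root_add]
      exact heven j r hjr hp'.symm
    · have : parity j ≠ parity i := fun h => hp h.symm
      simp [root_coroot, cartanInt, sign, this, hir.symm, hji.symm, hjr.symm]
    · rw [← neg_root, ← neg_root i j, ← neg_add, h, neg_zero]
    · rw [← neg_root, ← neg_root i j, ← neg_root k l, ← neg_add, h]

/-- If no even root is a weight, the module is trivial. -/
theorem act_eq_zero (h1 : 1 ≤ m + n) (ρ : (A F m n).Rep V)
    (hρ : ρ.HasWeightsIn (cartan F m n) ((A F m n).roots (cartan F m n) ∪ {0}))
    (heven : ∀ k l, k ≠ l → parity k = parity l →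
      ρ.weightSpace (cartan F m n) (root F k l) = ⊥) (x : slSpace F m n ⧸ scalars F m n) (v : V) :
    ρ.act x v = 0 := by
  have hw : ∀ μ, ρ.weightSpace (cartan F m n) μ ≠ ⊥ →
      μ = 0 ∨ ∃ k l, parity k ≠ parity l ∧ μ = root F k l := by
    intro μ hμ
    rcases hρ.2 μ hμ with h | h
    · obtain ⟨k, l, hkl, rfl⟩ := exists_eq_root F h
      exact Or.inr ⟨k, l, fun hp => hμ (heven k l hkl hp), rfl⟩
    · exact Or.inl h
  have hroot : ∀ {k l : Fin (m + 1) ⊕ Fin (n + 1)}, k ≠ l →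
      ρ.weightSpace (cartan F m n) (root F k l) = ⊥ := fun {k l} hkl => by
    by_cases hp : parity k = parity l
    · exact heven k l hkl hp
    · exact odd_root_weightSpace_eq_bot h1 ρ hw heven hp
  have hv : v ∈ ρ.weightSpace (cartan F m n) 0 := by
    have htop : (⊤ : Submodule F V) ≤ ρ.weightSpace (cartan F m n) 0 := by
      rw [← hρ.1]
      refine iSup_le fun μ => ?_
      by_cases hμ : ρ.weightSpace (cartan F m n) μ = ⊥
      · rw [hμ]
        exact bot_le
      · rcases hw μ hμ with rfl | ⟨k, l, hp, rfl⟩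
        · exact le_rfl
        · exact absurd (hroot fun h => hp (congrArg _ h)) hμ
    exact htop Submodule.mem_top
  have hx : x ∈ Submodule.span F
      ({x | ∃ k l, k ≠ l ∧ rootVec F k l = x} ∪ {x | x ∈ cartan F m n}) := by
    rw [span_rootVec]
    exact Submodule.mem_top
  induction hx using Submodule.span_induction with
  | mem z hz =>
    rcases hz with ⟨k, l, hkl, rfl⟩ | hz
    · have := act_rootVec_mem ρ hv k l
      rw [zero_add] at this
      exact (Submodule.eq_bot_iff _).1 (hroot hkl) _ this
    · have := hv ⟨z, hz⟩
      rwa [LinearMap.zero_apply, zero_smul] at this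
  | zero => simp
  | add a b _ _ ha hb => rw [map_add, LinearMap.add_apply, ha, hb, add_zero]
  | smul c a _ ha => rw [map_smul, LinearMap.smul_apply, ha, smul_zero]

end Weights

end TypeA

/-! ### Extremality of even roots -/

namespace TypeA

open LieSuperalgebra

section HighestWeight

variable {F : Type*} [Field F] {m n : ℕ} {V : Type*} [AddCommGroup V] [Module F V]

/-- On the coroot E_ii - E_jj of an even root, ε_k - ε_l reaches 2 only when k contributes 1 as i
and l contributes 1 as j. On an odd coroot the root itself would give 0. -/
theorem exists_weight_value {ρ : (A F m n).Rep V}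
    (hρ : ρ.HasWeightsIn (cartan F m n) ((A F m n).roots (cartan F m n) ∪ {0}))
    {i j : Fin (m + 1) ⊕ Fin (n + 1)} (hp : parity i = parity j)
    {μ : Module.Dual F (cartan F m n)} (hμ : ρ.weightSpace (cartan F m n) μ ≠ ⊥) :
    ∃ z : ℤ, μ (coroot F i j) = z ∧ z ≤ 2 ∧ (z = 2 → μ = root F i j) := by
  rcases hρ.2 μ hμ with h | h
  · obtain ⟨k, l, hkl, rfl⟩ := exists_eq_root F h
    refine ⟨cartanInt k l i j, root_coroot F k l i j, ?_, fun h => ?_⟩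
    · simp only [cartanInt, sign, hp, if_true]
      split_ifs <;> simp
    · have : k = i ∧ l = j := by
        simp only [cartanInt, sign, hp, if_true] at h
        clear hμ hρ
        grind
      rw [this.1, this.2]
  · obtain rfl : μ = 0 := h
    exact ⟨0, by simp, by simp, by simp⟩

/-- The sum of the weight spaces other than `V_α`. -/
def weightComplement (ρ : (A F m n).Rep V) (α : Module.Dual F (cartan F m n)) : Submodule F V :=
  ⨆ μ, ⨆ _ : μ ≠ α, ρ.weightSpace (cartan F m n) μ

theorem mem_weightComplement {ρ : (A F m n).Rep V} {α μ : Module.Dual F (cartan F m n)}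
    (h : μ ≠ α) {v : V} (hv : v ∈ ρ.weightSpace (cartan F m n) μ) :
    v ∈ weightComplement ρ α :=
  le_iSup₂ (f := fun (μ : Module.Dual F (cartan F m n)) (_ : μ ≠ α) =>
    ρ.weightSpace (cartan F m n) μ) μ h hv

variable [CharZero F]

/-- The coroot acts on V_α by 2 and on every other weight space by a scalar different from 2, and
eigenspaces are independent. -/
theorem notMem_weightComplement {ρ : (A F m n).Rep V}
    (hρ : ρ.HasWeightsIn (cartan F m n) ((A F m n).roots (cartan F m n) ∪ {0}))
    {i j : Fin (m + 1) ⊕ Fin (n + 1)} (hij : i ≠ j) (hp : parity i = parity j)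
    {v : V} (hv : v ∈ ρ.weightSpace (cartan F m n) (root F i j)) (hv0 : v ≠ 0) :
    v ∉ weightComplement ρ (root F i j) := by
  intro h
  have hle : weightComplement ρ (root F i j) ≤
      ⨆ c, ⨆ _ : c ≠ (2 : F), Module.End.eigenspace (ρ.act (coroot F i j).1) c := by
    refine iSup₂_le fun μ hμ => ?_
    by_cases hbot : ρ.weightSpace (cartan F m n) μ = ⊥
    · rw [hbot]
      exact bot_le
    · obtain ⟨z, hz, -, hz2⟩ := exists_weight_value hρ hp hbot
      refine le_trans (fun w hw => Module.End.mem_eigenspace_iff.2 (hw (coroot F i j)))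
        (le_iSup₂ (f := fun (c : F) (_ : c ≠ 2) =>
          Module.End.eigenspace (ρ.act (coroot F i j).1) c) (μ (coroot F i j)) fun h2 => ?_)
      rw [hz] at h2
      exact hμ (hz2 (by exact_mod_cast h2))
  have hv2 : v ∈ Module.End.eigenspace (ρ.act (coroot F i j).1) 2 := by
    refine Module.End.mem_eigenspace_iff.2 ((hv (coroot F i j)).trans ?_)
    congr 1
    simp only [root_coroot, cartanInt, sign, hp, hij, hij.symm]
    norm_num
  exact hv0 (Submodule.disjoint_def.1
    (Module.End.eigenspaces_iSupIndep (ρ.act (coroot F i j).1) 2) v hv2 (hle h))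

/-- The condition l = i or k = j makes ε_k - ε_l negative on the coroot. Since all weights have
value at most 2, the result has value below 2 and cannot have weight α. -/
theorem act_weightComplement {ρ : (A F m n).Rep V}
    (hρ : ρ.HasWeightsIn (cartan F m n) ((A F m n).roots (cartan F m n) ∪ {0}))
    {i j k l : Fin (m + 1) ⊕ Fin (n + 1)} (hij : i ≠ j) (hp : parity i = parity j)
    (hkl : k ≠ l) (h : l = i ∨ k = j) {v : V} (hv : v ∈ weightComplement ρ (root F i j)) :
    ρ.act (rootVec F k l) v ∈ weightComplement ρ (root F i j) := by
  have hle : weightComplement ρ (root F i j) ≤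
      (weightComplement ρ (root F i j)).comap (ρ.act (rootVec F k l)) := by
    refine iSup₂_le fun μ hμ w hw => ?_
    by_cases hbot : ρ.weightSpace (cartan F m n) μ = ⊥
    · rw [hbot, Submodule.mem_bot] at hw
      rw [hw]
      exact zero_mem _
    · refine mem_weightComplement (fun hα => ?_) (act_rootVec_mem ρ hw k l)
      obtain ⟨z, hz, hz2, -⟩ := exists_weight_value hρ hp hbot
      have h2 := congrArg (fun μ => μ (coroot F i j)) hα
      simp only [LinearMap.add_apply, root_coroot, hz] at h2
      norm_cast at h2
      simp only [cartanInt, sign, hp, if_true] at h2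
      clear hρ hμ hbot hα hz
      grind
  exact hle hv

/-- Here ε_k - ε_l is nonnegative on the coroot, so a nonzero image would have value 2, hence weight
α again, making ε_k - ε_l zero. -/
theorem act_rootVec_highest {ρ : (A F m n).Rep V} (h1 : 1 ≤ m + n)
    (hρ : ρ.HasWeightsIn (cartan F m n) ((A F m n).roots (cartan F m n) ∪ {0}))
    {i j k l : Fin (m + 1) ⊕ Fin (n + 1)} (hij : i ≠ j) (hp : parity i = parity j)
    (hkl : k ≠ l) (hl : l ≠ i) (hk : k ≠ j) {v : V}
    (hv : v ∈ ρ.weightSpace (cartan F m n) (root F i j)) : ρ.act (rootVec F k l) v = 0 := by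
  by_contra h0
  have hmem := act_rootVec_mem ρ hv k l
  obtain ⟨z, hz, hz2, hz3⟩ := exists_weight_value hρ hp
    ((Submodule.ne_bot_iff _).2 ⟨_, hmem, h0⟩)
  rw [LinearMap.add_apply, root_coroot, root_coroot] at hz
  norm_cast at hz
  have hz' : z = 2 := by
    simp only [cartanInt, sign, hp, if_true] at hz
    clear hρ hmem hv h0 hz3
    grind
  exact root_ne_zero h1 hkl (add_eq_left.1 (hz3 hz'))

/-- Two irreducible modules with weights in `Δ ∪ {0}` which both have the even root
`ε_i - ε_j` as a weight are isomorphic if their weight vectors have the same parity. -/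
theorem isIso_of_even_root {W : Type*} [AddCommGroup W] [Module F W] (h1 : 1 ≤ m + n)
    {ρ : (A F m n).Rep V} {σ : (A F m n).Rep W} (hρi : ρ.IsIrreducible) (hσi : σ.IsIrreducible)
    (hρ : ρ.HasWeightsIn (cartan F m n) ((A F m n).roots (cartan F m n) ∪ {0}))
    (hσ : σ.HasWeightsIn (cartan F m n) ((A F m n).roots (cartan F m n) ∪ {0}))
    {i j : Fin (m + 1) ⊕ Fin (n + 1)} (hij : i ≠ j) (hp : parity i = parity j) {s : ZMod 2}
    {v : V} {w : W} (hvs : v ∈ ρ.grading.part s) (hws : w ∈ σ.grading.part s)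
    (hv : v ∈ ρ.weightSpace (cartan F m n) (root F i j))
    (hw : w ∈ σ.weightSpace (cartan F m n) (root F i j)) (hv0 : v ≠ 0) (hw0 : w ≠ 0) :
    ρ.IsIso σ := by
  have hne : ∀ {k l}, k ≠ l → root F i j + root F k l ≠ root F i j := fun hkl h =>
    root_ne_zero h1 hkl (add_eq_left.1 h)
  refine Rep.isIso_of_highest hρi hσi
    (S := {x | ∃ k l, k ≠ l ∧ l ≠ i ∧ k ≠ j ∧ rootVec F k l = x} ∪ {x | x ∈ cartan F m n})
    (T := {x | ∃ k l, k ≠ l ∧ (l = i ∨ k = j) ∧ rootVec F k l = x})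
    ?_ ?_ ?_ hvs hws ?_ (notMem_weightComplement hρ hij hp hv hv0)
    (notMem_weightComplement hσ hij hp hw hw0) ?_ ?_ ?_ ?_
  · rintro _ (⟨k, l, -, -, -, rfl⟩ | hx)
    · exact ⟨_, rootVec_mem_part F k l⟩
    · exact ⟨0, cartan_le_even F hx⟩
  · rintro _ ⟨k, l, -, -, rfl⟩
    exact ⟨_, rootVec_mem_part F k l⟩
  · rw [eq_top_iff, ← span_rootVec F]
    refine Submodule.span_mono ?_
    rintro _ (⟨k, l, hkl, rfl⟩ | hx)
    · by_cases h : l = i ∨ k = j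
      · exact Or.inr ⟨k, l, hkl, h, rfl⟩
      · rw [not_or] at h
        exact Or.inl (Or.inl ⟨k, l, hkl, h.1, h.2, rfl⟩)
    · exact Or.inl (Or.inr hx)
  · rintro x (⟨k, l, hkl, hl, hk, rfl⟩ | hx)
    · exact ⟨0, by rw [act_rootVec_highest h1 hρ hij hp hkl hl hk hv, zero_smul],
        by rw [act_rootVec_highest h1 hσ hij hp hkl hl hk hw, zero_smul]⟩
    · exact ⟨root F i j ⟨x, hx⟩, hv ⟨x, hx⟩, hw ⟨x, hx⟩⟩
  · rintro _ ⟨k, l, hkl, -, rfl⟩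
    exact mem_weightComplement (hne hkl) (act_rootVec_mem ρ hv k l)
  · rintro _ ⟨k, l, hkl, -, rfl⟩
    exact mem_weightComplement (hne hkl) (act_rootVec_mem σ hw k l)
  · rintro _ ⟨k, l, hkl, h, rfl⟩ y hy
    exact act_weightComplement hρ hij hp hkl h hy
  · rintro _ ⟨k, l, hkl, h, rfl⟩ y hy
    exact act_weightComplement hσ hij hp hkl h hy

end HighestWeight

end TypeA

/-! ### The classification -/

theorem theorem2p4 {F : Type*} [Field F] [CharZero F] (m n : ℕ) (hmn : n ≤ m) (h1 : 1 ≤ m + n)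
    {V : Type*} [AddCommGroup V] [Module F V] (ρ : (TypeA.A F m n).Rep V) :
    (FiniteDimensional F V ∧ ρ.IsIrreducible ∧
      ρ.HasWeightsIn (TypeA.cartan F m n)
        ((TypeA.A F m n).roots (TypeA.cartan F m n) ∪ {0})) ↔
    (ρ.IsIso (TypeA.A F m n).adjointRep ∨ ρ.IsIso (TypeA.A F m n).adjointRep.parityChange ∨
      ρ.IsIso (TypeA.A F m n).trivialRep ∨ ρ.IsIso (TypeA.A F m n).trivialRep.parityChange) := by
  have hai := TypeA.adjointRep_isIrreducible (F := F) h1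
  have haw := TypeA.adjointRep_hasWeightsIn F (m := m) (n := n)
  constructor
  · rintro ⟨-, hi, hw⟩
    by_cases heven : ∀ k l : Fin (m + 1) ⊕ Fin (n + 1), k ≠ l → TypeA.parity k = TypeA.parity l →
      ρ.weightSpace (TypeA.cartan F m n) (TypeA.root F k l) = ⊥
    · exact Or.inr (Or.inr (LieSuperalgebra.Rep.isIso_trivialRep hi (TypeA.act_eq_zero h1 ρ hw heven)))
    · push Not at heven
      obtain ⟨i, j, hij, hp, hV⟩ := heven
      obtain ⟨s, v, hvs, hv, hv0⟩ := LieSuperalgebra.Rep.exists_homogeneous_weight (TypeA.cartan_le_even F) hV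
      have h0 : TypeA.parity i + TypeA.parity j = 0 := (TypeA.zmod2_add_eq _ _).2 hp
      have hE := TypeA.rootVec_mem_part F i j
      rw [h0] at hE
      -- The root vector is even in the adjoint module, so the parity of `v` decides between that
      -- module and its parity change.
      rcases zmod_two_cases s with rfl | rfl
      · exact Or.inl (TypeA.isIso_of_even_root h1 hi hai hw haw hij hp hvs hE hv
          (TypeA.rootVec_mem_weightSpace F i j) hv0 (TypeA.rootVec_ne_zero F hij))
      · refine Or.inr (Or.inl (TypeA.isIso_of_even_root h1 hi hai.parityChange hw haw.parityChange hij hp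
          hvs ?_ hv (TypeA.rootVec_mem_weightSpace F i j) hv0 (TypeA.rootVec_ne_zero F hij)))
        exact hE
  · have key : ∀ {W : Type _} [AddCommGroup W] [Module F W] [FiniteDimensional F W]
        {σ : (TypeA.A F m n).Rep W}, σ.IsIrreducible → σ.HasWeightsIn (TypeA.cartan F m n)
        ((TypeA.A F m n).roots (TypeA.cartan F m n) ∪ {0}) → ρ.IsIso σ →
        (FiniteDimensional F V ∧ ρ.IsIrreducible ∧ ρ.HasWeightsIn (TypeA.cartan F m n)
        ((TypeA.A F m n).roots (TypeA.cartan F m n) ∪ {0})) := fun hσi hσw h => by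
      refine ⟨?_, LieSuperalgebra.Rep.isIrreducible_of_isIso h hσi,
        LieSuperalgebra.Rep.hasWeightsIn_of_isIso h hσw⟩
      obtain ⟨e, -, -⟩ := h
      exact Module.Finite.equiv e.symm
    have htw : (TypeA.A F m n).trivialRep.HasWeightsIn (TypeA.cartan F m n)
        ((TypeA.A F m n).roots (TypeA.cartan F m n) ∪ {0}) :=
      LieSuperalgebra.Rep.trivialRep_hasWeightsIn (Or.inr rfl)
    rintro (h | h | h | h)
    · exact key hai haw h
    · exact key hai.parityChange haw.parityChange h
    · exact key LieSuperalgebra.Rep.trivialRep_isIrreducible htw h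
    · exact key LieSuperalgebra.Rep.trivialRep_isIrreducible.parityChange htw.parityChange h
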